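/- Let $\Lambda$ be an artin algebra, that is, an algebra over a commutative artinian ring $R$ which is finitely generated as an $R$-module. Let $\mathrm{mod}\,\Lambda$ be the category of finitely generated left $\Lambda$-modules, and let $\Gamma=\begin{pmatrix}\Lambda&0\\ \Lambda&\Lambda\end{pmatrix}$. A finitely generated $\Gamma$-module is identified with a triple $(M_1,M_2,f)$, where $f:M_1\to M_2$ is a morphism of $\mathrm{mod}\,\Lambda$: the module is $M_1\oplus M_2$, with $\begin{pmatrix}a&0\\ b&c\end{pmatrix}(x,y)=(ax,\;b f(x)+cy)$, and a morphism $(j_1,j_2):(N_1,N_2,g)\to(E_1,E_2,h)$ is a pair of $\Lambda$-linear maps $j_i:N_i\to E_i$ with $hj_1=j_2g$. Let $\mathrm{mod}(\mathrm{mod}\,\Lambda)$ be the category of finitely presented functors, i.e. contravariant additive functors $F$ from $\mathrm{mod}\,\Lambda$ to abelian groups with an exact sequence $(-,X_1)\to(-,X_0)\to F\to 0$, where $(-,X)=\mathrm{Hom}_\Lambda(-,X)$. Let $\Phi$ be the functor from maps of $\mathrm{mod}\,\Lambda$ to $\mathrm{mod}(\mathrm{mod}\,\Lambda)$ given by $$\Phi(M_1\xrightarrow{f}M_2)=\mathrm{Coker}\big((-,M_1)\xrightarrow{(-,f)}(-,M_2)\big),$$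 and by the induced maps of cokernels on morphisms. In either category, an almost split sequence is an exact sequence $0\to A\xrightarrow{a}B\xrightarrow{b}C\to0$ such that $a$ is left almost split ($a$ is not a split monomorphism, and every morphism $A\to X$ of the category that is not a split monomorphism factors through $a$) and $b$ is right almost split ($b$ is not a split epimorphism, and every morphism $X\to C$ of the category that is not a split epimorphism factors through $b$). **(1)** Let $$0\to(N_1,N_2,g)\xrightarrow{(j_1,j_2)}(E_1,E_2,h)\xrightarrow{(p_1,p_2)}(M_1,M_2,f)\to0$$ be an almost split sequence of finitely generated $\Gamma$-modules such that neither $g$ nor $f$ is a split epimorphism or a split monomorphism of $\Lambda$-modules. Then the sequence obtained by applying $\Phi$, $$0\to G\xrightarrow{\rho}H\xrightarrow{\theta}F\to0,\qquad G=\Phi(g),\; H=\Phi(h),\; F=\Phi(f),$$ is exact and is an almost split sequence in $\mathrm{mod}(\mathrm{mod}\,\Lambda)$. **(2)** Conversely, every almost split sequence $0\to G\xrightarrow{\rho}H\xrightarrow{\theta}F\to0$ in $\mathrm{mod}(\mathrm{mod}\,\Lambda)$ is isomorphic, as a sequence, to the one obtained by applying $\Phi$ to some almost split sequence $0\to(N_1,N_2,g)\to(E_1,E_2,h)\to(M_1,M_2,f)\to0$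 of finitely generated $\Gamma$-modules. This sequence can be chosen so that $f$ is neither a split epimorphism nor a split monomorphism, $g$ is not a split epimorphism, and $g$ is not a split monomorphism either unless $G$ is isomorphic to a representable functor $(-,X)$ with $X$ in $\mathrm{mod}\,\Lambda$. -/

import Mathlib

open CategoryTheory CategoryTheory.Limits Opposite

universe v u w

noncomputable section

namespace MapsCat

/-! ### Almost split sequences

`P` is a property of objects of an abelian category `A`; the definitions are about the full
subcategory of `A` on the objects satisfying `P`. -/

section AlmostSplit

variable {A : Type w} [Category.{v} A]

/-- `a : X ⟶ Y` is left almost split among the objects with property `P`: it is not a split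
monomorphism, and every morphism from `X` to an object with `P` which is not a split monomorphism
factors through `a`. -/
def IsLeftAlmostSplit (P : ObjectProperty A) {X Y : A} (a : X ⟶ Y) : Prop :=
  ¬ IsSplitMono a ∧
    ∀ (Z : A), P Z → ∀ h : X ⟶ Z, ¬ IsSplitMono h → ∃ k : Y ⟶ Z, a ≫ k = h

/-- `b : Y ⟶ Z` is right almost split among the objects with property `P`: it is not a split
epimorphism, and every morphism to `Z` from an object with `P` which is not a split epimorphism
factors through `b`. -/
def IsRightAlmostSplit (P : ObjectProperty A) {Y Z : A} (b : Y ⟶ Z) : Prop :=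
  ¬ IsSplitEpi b ∧
    ∀ (X : A), P X → ∀ h : X ⟶ Z, ¬ IsSplitEpi h → ∃ k : X ⟶ Y, k ≫ b = h

/-- `0 ⟶ X ⟶ Y ⟶ Z ⟶ 0` (with maps `a` and `b`) is an almost split sequence in the full
subcategory of objects with property `P`: its terms satisfy `P`, it is exact, `a` is left almost
split and `b` is right almost split. -/
def IsAlmostSplitSeq [Abelian A] (P : ObjectProperty A) {X Y Z : A}
    (a : X ⟶ Y) (b : Y ⟶ Z) : Prop :=
  P X ∧ P Y ∧ P Z ∧
    (∃ hab : a ≫ b = 0, (ShortComplex.mk a b hab).ShortExact) ∧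
      IsLeftAlmostSplit P a ∧ IsRightAlmostSplit P b

end AlmostSplit

/-! ### Finitely presented functors and the functor `Φ` -/

section Functors

variable {C : Type w} [Category.{v} C] [Preadditive C]

/-- The objects of `mod(C)`: the finitely presented contravariant additive functors `F` from `C`
to abelian groups, i.e. those with an exact sequence `C(-,C₁) ⟶ C(-,C₀) ⟶ F ⟶ 0`. -/
def IsFinPres : ObjectProperty (Cᵒᵖ ⥤ AddCommGrpCat.{v}) := fun F =>
  F.Additive ∧
    ∃ (C₁ C₀ : C) (f : C₁ ⟶ C₀) (π : preadditiveYoneda.obj C₀ ⟶ F)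
      (hπ : preadditiveYoneda.map f ≫ π = 0),
      (ShortComplex.mk (preadditiveYoneda.map f) π hπ).Exact ∧ Epi π

/-- `F` is isomorphic to a representable functor `C(-,X)`. -/
def IsRepr (F : Cᵒᵖ ⥤ AddCommGrpCat.{v}) : Prop :=
  ∃ X : C, Nonempty (preadditiveYoneda.obj X ≅ F)

/-- The functor `Φ` on the category of maps of `C`, sending `f : A₁ ⟶ A₀` to the cokernel of
`C(-,f) : C(-,A₁) ⟶ C(-,A₀)`, and a commutative square to the induced map of cokernels. -/
def Phi : Arrow C ⥤ Cᵒᵖ ⥤ AddCommGrpCat.{v} where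
  obj f := cokernel (preadditiveYoneda.map f.hom)
  map {f g} h := cokernel.map (preadditiveYoneda.map f.hom) (preadditiveYoneda.map g.hom)
    (preadditiveYoneda.map h.left) (preadditiveYoneda.map h.right)
    (by rw [← Functor.map_comp, ← Functor.map_comp, Arrow.w])
  map_id f := by
    apply coequalizer.hom_ext
    simp
  map_comp f g := by
    apply coequalizer.hom_ext
    simp

end Functors

/-! ### The triangular matrix ring and its modules as maps -/

section Triangular

variable (L : Type u) [Ring L]

/-- The ring `[[L, 0], [L, L]]` of lower triangular `2 × 2` matrices over `L`. -/
def Tri : Subring (Matrix (Fin 2) (Fin 2) L) where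
  carrier := {m | m 0 1 = 0}
  zero_mem' := rfl
  one_mem' := by simp
  add_mem' {a b} ha hb := by
    simp only [Set.mem_ofPred_eq] at ha hb ⊢
    simp [ha, hb]
  neg_mem' {a} ha := by
    simp only [Set.mem_ofPred_eq] at ha ⊢
    simp [ha]
  mul_mem' {a b} ha hb := by
    simp only [Set.mem_ofPred_eq] at ha hb ⊢
    simp [Matrix.mul_apply, ha, hb]

variable {L}

/-- The abelian group `M₁ × M₂` underlying the module of a map `f : M₁ ⟶ M₂`. -/
def TriSpace (f : Arrow (FGModuleCat.{u} L)) : Type u := f.left × f.right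

instance (f : Arrow (FGModuleCat.{u} L)) : AddCommGroup (TriSpace f) :=
  inferInstanceAs (AddCommGroup (f.left × f.right))

/-- The matrix `[[a, 0], [b, c]]` acts on the column `(x, y)` of `M₁ × M₂` by
`(a x, b f(x) + c y)`. -/
instance (f : Arrow (FGModuleCat.{u} L)) : Module (Tri L) (TriSpace f) where
  smul m x := (m.1 0 0 • x.1, m.1 1 0 • f.hom.hom.hom x.1 + m.1 1 1 • x.2)
  one_smul x := by
    refine Prod.ext ?_ ?_
    · change (1 : Matrix (Fin 2) (Fin 2) L) 0 0 • x.1 = x.1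
      simp
    · change (1 : Matrix (Fin 2) (Fin 2) L) 1 0 • f.hom.hom.hom x.1 +
        (1 : Matrix (Fin 2) (Fin 2) L) 1 1 • x.2 = x.2
      simp
  mul_smul m n x := by
    have hm : m.1 0 1 = 0 := m.2
    have hn : n.1 0 1 = 0 := n.2
    refine Prod.ext ?_ ?_
    · change (m.1 * n.1) 0 0 • x.1 = m.1 0 0 • n.1 0 0 • x.1
      simp [Matrix.mul_apply, hm, mul_smul]
    · change (m.1 * n.1) 1 0 • f.hom.hom.hom x.1 + (m.1 * n.1) 1 1 • x.2 =
        m.1 1 0 • f.hom.hom.hom (n.1 0 0 • x.1) +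
          m.1 1 1 • (n.1 1 0 • f.hom.hom.hom x.1 + n.1 1 1 • x.2)
      simp [Matrix.mul_apply, hn, mul_smul, add_smul, add_assoc]
  smul_zero m := by
    refine Prod.ext ?_ ?_
    · change m.1 0 0 • (0 : f.left) = 0
      simp
    · change m.1 1 0 • f.hom.hom.hom (0 : f.left) + m.1 1 1 • (0 : f.right) = 0
      simp
  smul_add m x y := by
    refine Prod.ext ?_ ?_
    · change m.1 0 0 • (x.1 + y.1) = m.1 0 0 • x.1 + m.1 0 0 • y.1
      simp
    · change m.1 1 0 • f.hom.hom.hom (x.1 + y.1) + m.1 1 1 • (x.2 + y.2) =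
        (m.1 1 0 • f.hom.hom.hom x.1 + m.1 1 1 • x.2) +
          (m.1 1 0 • f.hom.hom.hom y.1 + m.1 1 1 • y.2)
      simp only [map_add, smul_add]
      abel
  add_smul m n x := by
    refine Prod.ext ?_ ?_
    · change (m.1 + n.1) 0 0 • x.1 = m.1 0 0 • x.1 + n.1 0 0 • x.1
      simp [add_smul]
    · change (m.1 + n.1) 1 0 • f.hom.hom.hom x.1 + (m.1 + n.1) 1 1 • x.2 =
        (m.1 1 0 • f.hom.hom.hom x.1 + m.1 1 1 • x.2) +
          (n.1 1 0 • f.hom.hom.hom x.1 + n.1 1 1 • x.2)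
      simp only [Matrix.add_apply, add_smul]
      abel
  zero_smul x := by
    refine Prod.ext ?_ ?_
    · change (0 : Matrix (Fin 2) (Fin 2) L) 0 0 • x.1 = 0
      simp
    · change (0 : Matrix (Fin 2) (Fin 2) L) 1 0 • f.hom.hom.hom x.1 +
        (0 : Matrix (Fin 2) (Fin 2) L) 1 1 • x.2 = 0
      simp

/-- The map of modules over the triangular matrix ring given by a commutative square. -/
def triMap {f g : Arrow (FGModuleCat.{u} L)} (h : f ⟶ g) :
    TriSpace f →ₗ[Tri L] TriSpace g where
  toFun x := (h.left.hom.hom x.1, h.right.hom.hom x.2)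
  map_add' x y := by
    refine Prod.ext ?_ ?_
    · change h.left.hom.hom (x.1 + y.1) = h.left.hom.hom x.1 + h.left.hom.hom y.1
      simp
    · change h.right.hom.hom (x.2 + y.2) = h.right.hom.hom x.2 + h.right.hom.hom y.2
      simp
  map_smul' m x := by
    have w : ∀ z : f.left, g.hom.hom.hom (h.left.hom.hom z) = h.right.hom.hom (f.hom.hom.hom z) :=
      fun z => congrArg (fun k : f.left ⟶ g.right => k.hom.hom z) (Arrow.w h)
    refine Prod.ext ?_ ?_
    · change h.left.hom.hom (m.1 0 0 • x.1) = m.1 0 0 • h.left.hom.hom x.1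
      simp
    · change h.right.hom.hom (m.1 1 0 • f.hom.hom.hom x.1 + m.1 1 1 • x.2) =
        m.1 1 0 • g.hom.hom.hom (h.left.hom.hom x.1) + m.1 1 1 • h.right.hom.hom x.2
      rw [w]
      simp

/-- The functor identifying the maps `f : M₁ ⟶ M₂` of finitely generated `L`-modules with the
finitely generated modules `(M₁, M₂, f)` over the triangular matrix ring. -/
def toTri : Arrow (FGModuleCat.{u} L) ⥤ ModuleCat.{u} (Tri L) where
  obj f := ModuleCat.of (Tri L) (TriSpace f)
  map h := ModuleCat.ofHom (triMap h)
  map_id _ := rfl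
  map_comp _ _ := rfl

end Triangular

end MapsCat

end

/-! `toTri` is fully faithful and reaches every finitely generated module over `Tri L`, so
everything can be done in the category of maps. There `Phi` is full, it reaches every finitely
presented functor up to isomorphism, and it kills exactly the null-homotopic squares, those whose
right component factors through the target map (`phi_map_surjective`, `IsFinPres.exists_phi_iso`,
`phi_map_eq_zero_iff`). Both directions compare almost split sequences before and after dividing by
these squares.

From maps to functors: let `p : E ⟶ M` be right almost split with `M.hom` not a split mono. Testing
`p` on the identity of `M.left` and on `0 ⟶ M.right` shows that both rows of the sequence split, so
applying `Phi` is exact except perhaps for injectivity on the left; when `M.hom` is not a split epi,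
that follows by testing `p` on the maps `X ⟶ 0`. A splitting after `Phi` is a splitting up to
homotopy, and the error term also factors through `p` or `j`, which contradicts almost splitness
(`isAlmostSplitSeq_phi_map`).

From functors to maps: `G` and `F` have presentations of least total length. By Fitting's argument
these are rigid: an endomorphism inducing the identity on the functor is invertible
(`exists_isPhiRigid_iso`). The horseshoe construction gives a presentation of `H` with split rows
(`exists_ext_iso`). Rigidity lets non-split maps stay non-split under `Phi`, so they factor up to
homotopy, and null-homotopic maps factor because the rows split and `ρ` is injective
(`exists_almostSplit_of_isPhiRigid`). -/

namespace MapsCat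

/-! ### Elements of `Phi`, its fullness and its kernel -/

section PhiBasics

variable {C : Type w} [Category.{v} C] [Preadditive C]

/-- The class in `Φ(f)(X)` of a map from `X` to the target of `f`. -/
noncomputable def phiMk (f : Arrow C) {X : C} (n : X ⟶ f.right) : (Phi.obj f).obj (op X) :=
  (cokernel.π (preadditiveYoneda.map f.hom)).app (op X) n

lemma phiMk_add (f : Arrow C) {X : C} (m n : X ⟶ f.right) :
    phiMk f (m + n) = phiMk f m + phiMk f n :=
  map_add ((cokernel.π (preadditiveYoneda.map f.hom)).app (op X)).hom m n

lemma phiMk_sub (f : Arrow C) {X : C} (m n : X ⟶ f.right) :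
    phiMk f (m - n) = phiMk f m - phiMk f n :=
  map_sub ((cokernel.π (preadditiveYoneda.map f.hom)).app (op X)).hom m n

lemma exists_phiMk (f : Arrow C) {X : C} (z : (Phi.obj f).obj (op X)) : ∃ n, phiMk f n = z :=
  (AddCommGrpCat.epi_iff_surjective
    ((cokernel.π (preadditiveYoneda.map f.hom)).app (op X))).1 inferInstance z

lemma phiMk_eq_zero_iff (f : Arrow C) {X : C} (n : X ⟶ f.right) :
    phiMk f n = 0 ↔ ∃ t : X ⟶ f.left, t ≫ f.hom = n := by
  have h := (ShortComplex.exact_cokernel (preadditiveYoneda.map f.hom)).map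
    ((evaluation Cᵒᵖ AddCommGrpCat.{v}).obj (op X))
  rw [ShortComplex.ab_exact_iff_function_exact] at h
  exact h n

lemma phi_obj_map_phiMk (f : Arrow C) {X Y : C} (a : Y ⟶ X) (n : X ⟶ f.right) :
    (Phi.obj f).map a.op (phiMk f n) = phiMk f (a ≫ n) :=
  (ConcreteCategory.congr_hom
    ((cokernel.π (preadditiveYoneda.map f.hom)).naturality a.op) n).symm

lemma phi_map_app_phiMk {f g : Arrow C} (k : f ⟶ g) {X : C} (n : X ⟶ f.right) :
    (Phi.map k).app (op X) (phiMk f n) = phiMk g (n ≫ k.right) := by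
  have h : cokernel.π (preadditiveYoneda.map f.hom) ≫ Phi.map k =
      preadditiveYoneda.map k.right ≫ cokernel.π (preadditiveYoneda.map g.hom) :=
    cokernel.π_desc _ _ _
  exact ConcreteCategory.congr_hom (NatTrans.congr_app h (op X)) n

/-- Yoneda: `Phi.obj f` is generated by the class of the identity of `f.right`, so naturality
determines a transformation from its value there. -/
lemma app_phiMk {f : Arrow C} {F : Cᵒᵖ ⥤ AddCommGrpCat.{v}} (α : Phi.obj f ⟶ F) {X : C}
    (n : X ⟶ f.right) :
    α.app (op X) (phiMk f n) = F.map n.op (α.app (op f.right) (phiMk f (𝟙 f.right))) := by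
  have h := ConcreteCategory.congr_hom (α.naturality n.op) (phiMk f (𝟙 f.right))
  refine Eq.trans ?_ h
  change _ = α.app (op X) ((Phi.obj f).map n.op (phiMk f (𝟙 f.right)))
  rw [phi_obj_map_phiMk, Category.comp_id]

lemma phi_hom_ext {f : Arrow C} {F : Cᵒᵖ ⥤ AddCommGrpCat.{v}} {α β : Phi.obj f ⟶ F}
    (h : α.app (op f.right) (phiMk f (𝟙 f.right)) = β.app (op f.right) (phiMk f (𝟙 f.right))) :
    α = β := by
  ext X z
  obtain ⟨n, rfl⟩ := exists_phiMk f (X := X.unop) z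
  exact (app_phiMk α n).trans ((congrArg _ h).trans (app_phiMk β n).symm)

instance phi_obj_additive (f : Arrow C) : (Phi.obj f).Additive where
  map_add {X Y a b} := by
    ext z
    obtain ⟨n, rfl⟩ := exists_phiMk f (X := X.unop) z
    change (Phi.obj f).map (a + b).unop.op _ =
      (Phi.obj f).map a.unop.op _ + (Phi.obj f).map b.unop.op _
    rw [phi_obj_map_phiMk, phi_obj_map_phiMk, phi_obj_map_phiMk, ← phiMk_add]
    simp

/-- The evaluation of an additive functor along the maps from `X` to `Y` at an element of
`F(Y)`. -/
def evalHom (F : Cᵒᵖ ⥤ AddCommGrpCat.{v}) [F.Additive] {Y : C} (y : F.obj (op Y)) (X : C) :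
    (X ⟶ Y) →+ F.obj (op X) :=
  AddMonoidHom.mk' (fun n => F.map n.op y) fun m n => by
    rw [op_add, F.map_add]
    rfl

/-- The map from `Φ(f)` to an additive functor given by an element annihilated by `f`. -/
noncomputable def phiDesc (f : Arrow C) (F : Cᵒᵖ ⥤ AddCommGrpCat.{v}) [F.Additive]
    (y : F.obj (op f.right)) (hy : F.map f.hom.op y = 0) : Phi.obj f ⟶ F :=
  cokernel.desc _
    { app := fun X => AddCommGrpCat.ofHom (evalHom F y X.unop)
      naturality := fun X Y a => by
        ext n
        exact ConcreteCategory.congr_hom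
          (F.map_comp (Quiver.Hom.op (show X.unop ⟶ f.right from n)) a) y }
    (by
      ext X n
      change F.map ((show X.unop ⟶ f.left from n) ≫ f.hom).op y = 0
      rw [op_comp, F.map_comp]
      change F.map _ (F.map f.hom.op y) = 0
      rw [hy, map_zero])

lemma phiDesc_app_phiMk (f : Arrow C) (F : Cᵒᵖ ⥤ AddCommGrpCat.{v}) [F.Additive]
    (y : F.obj (op f.right)) (hy : F.map f.hom.op y = 0) {X : C} (n : X ⟶ f.right) :
    (phiDesc f F y hy).app (op X) (phiMk f n) = F.map n.op y :=
  ConcreteCategory.congr_hom (NatTrans.congr_app (cokernel.π_desc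
    (preadditiveYoneda.map f.hom) _ _) (op X)) n

/-- The image of the generator is represented by some `b`. As `f.hom` kills the generator, `f.hom ≫
b` has class zero, and this supplies the left side of the square. -/
lemma phi_map_surjective {f g : Arrow C} (α : Phi.obj f ⟶ Phi.obj g) :
    ∃ k : f ⟶ g, Phi.map k = α := by
  obtain ⟨b, hb⟩ := exists_phiMk g (α.app (op f.right) (phiMk f (𝟙 f.right)))
  have h : phiMk g (f.hom ≫ b) = 0 := by
    rw [← phi_obj_map_phiMk, hb, ← app_phiMk, (phiMk_eq_zero_iff f f.hom).2 ⟨𝟙 _, by simp⟩,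
      map_zero]
  obtain ⟨a, ha⟩ := (phiMk_eq_zero_iff g _).1 h
  refine ⟨Arrow.homMk a b ha, phi_hom_ext ?_⟩
  rw [phi_map_app_phiMk, ← hb]
  simp

lemma phi_map_eq_iff {f g : Arrow C} (k l : f ⟶ g) :
    Phi.map k = Phi.map l ↔ ∃ t : f.right ⟶ g.left, t ≫ g.hom = k.right - l.right := by
  rw [← phiMk_eq_zero_iff, phiMk_sub, sub_eq_zero]
  constructor
  · intro h
    have := ConcreteCategory.congr_hom (NatTrans.congr_app h (op f.right)) (phiMk f (𝟙 f.right))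
    rwa [phi_map_app_phiMk, phi_map_app_phiMk, Category.id_comp, Category.id_comp] at this
  · intro h
    apply phi_hom_ext
    rw [phi_map_app_phiMk, phi_map_app_phiMk, Category.id_comp, Category.id_comp, h]

lemma isFinPres_phi (f : Arrow C) : IsFinPres (Phi.obj f) :=
  ⟨phi_obj_additive f, f.left, f.right, f.hom, cokernel.π _, cokernel.condition _,
    ShortComplex.exact_cokernel _, coequalizer.π_epi⟩

lemma IsFinPres.exists_phi_iso {F : Cᵒᵖ ⥤ AddCommGrpCat.{v}} (hF : IsFinPres F) :
    ∃ f : Arrow C, Nonempty (Phi.obj f ≅ F) := by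
  obtain ⟨-, C₁, C₀, f, π, hπ, hex, hepi⟩ := hF
  have : Epi (ShortComplex.mk (preadditiveYoneda.map f) π hπ).g := hepi
  exact ⟨Arrow.mk f, ⟨(cokernelIsCokernel (preadditiveYoneda.map f)).coconePointUniqueUpToIso
    hex.gIsCokernel⟩⟩

end PhiBasics

/-! ### Exactness of functors is pointwise -/

section Pointwise

variable {D : Type w} [Category.{v} D]

lemma shortExact_iff_pointwise {G H F : D ⥤ AddCommGrpCat.{v}} (a : G ⟶ H) (b : H ⟶ F)
    (hab : a ≫ b = 0) :
    (ShortComplex.mk a b hab).ShortExact ↔ ∀ X : D, Function.Injective (a.app X) ∧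
      Function.Exact (a.app X) (b.app X) ∧ Function.Surjective (b.app X) := by
  constructor
  · intro h X
    have h' := h.map_of_exact ((evaluation D AddCommGrpCat.{v}).obj X)
    exact ⟨(AddCommGrpCat.mono_iff_injective _).1 h'.mono_f,
      (ShortComplex.ab_exact_iff_function_exact _).1 h'.exact,
      (AddCommGrpCat.epi_iff_surjective _).1 h'.epi_g⟩
  · intro h
    have hm : Mono a := (NatTrans.mono_iff_mono_app a).2 fun X =>
      (AddCommGrpCat.mono_iff_injective _).2 (h X).1
    have he : Epi b := (NatTrans.epi_iff_epi_app b).2 fun X =>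
      (AddCommGrpCat.epi_iff_surjective _).2 (h X).2.2
    refine @ShortComplex.ShortExact.mk _ _ _ _ ?_ hm he
    rw [ShortComplex.exact_iff_isZero_homology, Functor.isZero_iff]
    intro X
    refine IsZero.of_iso ?_ ((ShortComplex.mk a b hab).mapHomologyIso
      ((evaluation D AddCommGrpCat.{v}).obj X)).symm
    rw [← ShortComplex.exact_iff_isZero_homology, ShortComplex.ab_exact_iff_function_exact]
    exact (h X).2.1

end Pointwise

/-! ### Sequences of maps with split rows -/

section SplitRows

variable {C : Type w} [Category.{v} C] [Preadditive C]

/-- `0 ⟶ X ⟶ Y ⟶ Z ⟶ 0` is a split exact sequence. -/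
def IsSplitSeq {X Y Z : C} (a : X ⟶ Y) (b : Y ⟶ Z) : Prop :=
  a ≫ b = 0 ∧ ∃ (r : Y ⟶ X) (s : Z ⟶ Y), a ≫ r = 𝟙 X ∧ s ≫ b = 𝟙 Z ∧ r ≫ a + b ≫ s = 𝟙 Y

lemma IsSplitSeq.exists_lift {X Y Z : C} {a : X ⟶ Y} {b : Y ⟶ Z} (h : IsSplitSeq a b) {W : C}
    (k : W ⟶ Y) (hk : k ≫ b = 0) : ∃ l : W ⟶ X, l ≫ a = k := by
  obtain ⟨-, r, s, -, -, h⟩ := h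
  refine ⟨k ≫ r, ?_⟩
  have := k ≫= h
  rw [Preadditive.comp_add, reassoc_of% hk, zero_comp, add_zero, Category.comp_id] at this
  rw [Category.assoc, this]

lemma IsSplitSeq.cancel {X Y Z : C} {a : X ⟶ Y} {b : Y ⟶ Z} (h : IsSplitSeq a b) {W : C}
    {k l : W ⟶ X} (hk : k ≫ a = l ≫ a) : k = l := by
  obtain ⟨-, r, s, hr, -, -⟩ := h
  simpa [hr] using hk =≫ r

/-- A pair of maps of arrows whose two rows are split exact sequences. -/
def HasSplitRows {N E M : Arrow C} (j : N ⟶ E) (p : E ⟶ M) : Prop :=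
  IsSplitSeq j.left p.left ∧ IsSplitSeq j.right p.right

lemma HasSplitRows.comp_eq_zero {N E M : Arrow C} {j : N ⟶ E} {p : E ⟶ M}
    (h : HasSplitRows j p) : j ≫ p = 0 := by
  ext
  · exact h.1.1
  · exact h.2.1

/-- The maps of arrows sent to `0` by `Φ` are the null-homotopic ones. -/
lemma phi_map_eq_zero_iff {f g : Arrow C} (k : f ⟶ g) :
    Phi.map k = 0 ↔ ∃ t : f.right ⟶ g.left, t ≫ g.hom = k.right := by
  have h0 : Phi.map (0 : f ⟶ g) = 0 := by
    apply phi_hom_ext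
    rw [phi_map_app_phiMk]
    exact (congrArg (phiMk g) comp_zero).trans ((phiMk_eq_zero_iff g _).2 ⟨0, zero_comp⟩)
  rw [← h0, phi_map_eq_iff]
  change (∃ t, t ≫ g.hom = k.right - 0) ↔ _
  rw [sub_zero]

/-- Split rows make the sequence of cokernels exact in the middle and on the right; `hinj` is
exactly injectivity of `Phi.map j`, unwound on representatives. -/
lemma HasSplitRows.phi_shortExact {N E M : Arrow C} {j : N ⟶ E} {p : E ⟶ M}
    (h : HasSplitRows j p)
    (hinj : ∀ {X : C} (n : X ⟶ N.right) (e : X ⟶ E.left), e ≫ E.hom = n ≫ j.right →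
      ∃ t, t ≫ N.hom = n) :
    ∃ hjp : Phi.map j ≫ Phi.map p = 0,
      (ShortComplex.mk (Phi.map j) (Phi.map p) hjp).ShortExact := by
  have hjp : Phi.map j ≫ Phi.map p = 0 := by
    rw [← Functor.map_comp, h.comp_eq_zero, phi_map_eq_zero_iff]
    exact ⟨0, zero_comp⟩
  refine ⟨hjp, (shortExact_iff_pointwise _ _ hjp).2 fun X => ⟨?_, ?_, ?_⟩⟩
  · rw [injective_iff_map_eq_zero]
    intro z hz
    obtain ⟨n, rfl⟩ := exists_phiMk N (X := X.unop) z
    replace hz := (phi_map_app_phiMk j n).symm.trans hz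
    obtain ⟨e, he⟩ := (phiMk_eq_zero_iff _ _).1 hz
    exact (phiMk_eq_zero_iff _ _).2 (hinj n e he)
  · intro z
    constructor
    · intro hz
      obtain ⟨n, rfl⟩ := exists_phiMk E (X := X.unop) z
      replace hz := (phi_map_app_phiMk p n).symm.trans hz
      obtain ⟨t, ht⟩ := (phiMk_eq_zero_iff _ _).1 hz
      obtain ⟨-, r, s, -, hs, -⟩ := h.1
      have hw : s ≫ E.hom ≫ p.right = M.hom := by
        rw [← Arrow.w p, reassoc_of% hs]
      -- Subtracting `t ≫ s ≫ E.hom` does not change the class of `n`, and makes it vanish in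
      -- `M.right` itself.
      obtain ⟨l, hl⟩ := h.2.exists_lift (n - t ≫ s ≫ E.hom) (by
        rw [Preadditive.sub_comp, Category.assoc, Category.assoc, hw, ht, sub_self])
      refine ⟨phiMk N l, (phi_map_app_phiMk j l).trans ?_⟩
      rw [hl, phiMk_sub, (phiMk_eq_zero_iff E (t ≫ s ≫ E.hom)).2 ⟨t ≫ s, by simp⟩, sub_zero]
    · rintro ⟨y, rfl⟩
      exact ConcreteCategory.congr_hom (NatTrans.congr_app hjp X) y
  · intro z
    obtain ⟨m, rfl⟩ := exists_phiMk M (X := X.unop) z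
    obtain ⟨-, r, s, -, hs, -⟩ := h.2
    refine ⟨phiMk E (m ≫ s), (phi_map_app_phiMk p _).trans ?_⟩
    rw [Category.assoc, hs, Category.comp_id]

end SplitRows

/-! ### From almost split sequences of maps to functors -/

section FromMaps

variable {C : Type w} [Category.{v} C] [Preadditive C]

/-- The test map is `(𝟙, M.hom)` from the identity of `M.left` to `M`; a section of it would provide
a retraction of `M.hom`. -/
lemma IsRightAlmostSplit.exists_section_left {C : Type w} [Category.{v} C] {E M : Arrow C}
    {p : E ⟶ M}
    (hp : IsRightAlmostSplit ⊤ p) (hM : ¬ IsSplitMono M.hom) :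
    ∃ s, s ≫ p.left = 𝟙 M.left := by
  obtain ⟨k, hk⟩ := hp.2 (Arrow.mk (𝟙 M.left)) trivial (Arrow.homMk (𝟙 _) M.hom) (by
    rintro ⟨⟨s, hs⟩⟩
    have h1 := congrArg CommaMorphism.left hs
    have h2 := Arrow.w s
    simp at h1 h2
    exact hM ⟨⟨s.right, by rw [← h2, h1]⟩⟩)
  exact ⟨k.left, by simpa using congrArg CommaMorphism.left hk⟩

/-- The test map goes from `0 ⟶ M.right`; if it were a split epi, `M.left` would be zero and `M.hom`
a split mono. -/
lemma IsRightAlmostSplit.exists_section_right [HasZeroObject C] {E M : Arrow C} {p : E ⟶ M}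
    (hp : IsRightAlmostSplit ⊤ p) (hM : ¬ IsSplitMono M.hom) :
    ∃ s, s ≫ p.right = 𝟙 M.right := by
  open ZeroObject in
  obtain ⟨k, hk⟩ := hp.2 (Arrow.mk (0 : (0 : C) ⟶ M.right)) trivial
    (Arrow.homMk (0 : (0 : C) ⟶ M.left) (𝟙 _)) (by
      rintro ⟨⟨s, hs⟩⟩
      have h1 := congrArg CommaMorphism.left hs
      simp at h1
      exact hM ⟨⟨0, by rw [comp_zero, h1]⟩⟩)
  exact ⟨k.right, by simpa using congrArg CommaMorphism.right hk⟩

/-- Maps to the source of `M` annihilated by `M` lift along a right almost split map. -/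
lemma IsRightAlmostSplit.exists_lift_left [HasZeroObject C] {E M : Arrow C} {p : E ⟶ M}
    (hp : IsRightAlmostSplit ⊤ p) (hM : ¬ IsSplitEpi M.hom) {X : C} (k : X ⟶ M.left)
    (hk : k ≫ M.hom = 0) : ∃ e : X ⟶ E.left, e ≫ p.left = k ∧ e ≫ E.hom = 0 := by
  open ZeroObject in
  -- A section of this test map would force `M.right` to be zero, so that `M.hom` would be a split
  -- epi.
  obtain ⟨l, hl⟩ := hp.2 (Arrow.mk (0 : X ⟶ (0 : C))) trivial
    (Arrow.homMk k (0 : (0 : C) ⟶ M.right) (by simp [hk])) (by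
      rintro ⟨⟨s, hs⟩⟩
      have h1 := congrArg CommaMorphism.right hs
      simp at h1
      exact hM ⟨⟨0, by rw [zero_comp, h1]⟩⟩)
  refine ⟨l.left, by simpa using congrArg CommaMorphism.left hl, ?_⟩
  rw [Arrow.w l]
  exact zero_comp

lemma IsRightAlmostSplit.phi_map {E M : Arrow C} {p : E ⟶ M}
    (hp : IsRightAlmostSplit ⊤ p) (hM : ¬ IsSplitEpi M.hom) :
    IsRightAlmostSplit IsFinPres (Phi.map p) := by
  constructor
  · rintro ⟨⟨σ, hσ⟩⟩
    obtain ⟨s, rfl⟩ := phi_map_surjective σ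
    rw [← Functor.map_comp, ← Phi.map_id, eq_comm, phi_map_eq_iff] at hσ
    obtain ⟨t, ht⟩ := hσ
    -- The right component of `𝟙 M - s ≫ p` factors through `M.hom`, so a section of this map would
    -- split `M.hom`. Hence it factors through `p`, and so does `𝟙 M`.
    obtain ⟨k, hk⟩ := hp.2 M trivial (𝟙 M - s ≫ p) (by
      rintro ⟨⟨q, hq⟩⟩
      have h1 : q.right ≫ (𝟙 M - s ≫ p).right = 𝟙 _ := congrArg CommaMorphism.right hq
      change q.right ≫ ((𝟙 M : M ⟶ M).right - (s ≫ p).right) = 𝟙 _ at h1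
      rw [← ht] at h1
      exact hM ⟨⟨q.right ≫ t, by simpa using h1⟩⟩)
    exact hp.1 ⟨⟨k + s, by rw [Preadditive.add_comp, hk]; simp⟩⟩
  · intro X hX h hh
    obtain ⟨x, ⟨i⟩⟩ := hX.exists_phi_iso
    obtain ⟨k, hk⟩ := phi_map_surjective (i.hom ≫ h)
    obtain ⟨l, hl⟩ := hp.2 x trivial k (by
      rintro ⟨⟨s, hs⟩⟩
      refine hh ⟨⟨Phi.map s ≫ i.hom, ?_⟩⟩
      rw [Category.assoc, ← hk, ← Functor.map_comp, hs, Phi.map_id])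
    exact ⟨i.inv ≫ Phi.map l, by rw [Category.assoc, ← Functor.map_comp, hl, hk]; simp⟩

/-- Dual to the previous argument except at one point: a retraction of the error term makes `t ≫
N.hom` only a split mono endomorphism of `N.right`. Finiteness, in the form `hfin`, makes it
invertible, and then `N.hom` is a split epi. -/
lemma IsLeftAlmostSplit.phi_map {N E : Arrow C} {j : N ⟶ E}
    (hfin : ∀ e : N.right ⟶ N.right, IsSplitMono e → IsIso e)
    (hj : IsLeftAlmostSplit ⊤ j) (hN : ¬ IsSplitEpi N.hom) :
    IsLeftAlmostSplit IsFinPres (Phi.map j) := by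
  constructor
  · rintro ⟨⟨σ, hσ⟩⟩
    obtain ⟨s, rfl⟩ := phi_map_surjective σ
    rw [← Functor.map_comp, ← Phi.map_id, eq_comm, phi_map_eq_iff] at hσ
    obtain ⟨t, ht⟩ := hσ
    obtain ⟨k, hk⟩ := hj.2 N trivial (𝟙 N - j ≫ s) (by
      rintro ⟨⟨q, hq⟩⟩
      have h1 : (𝟙 N - j ≫ s).right ≫ q.right = 𝟙 _ := congrArg CommaMorphism.right hq
      change ((𝟙 N : N ⟶ N).right - (j ≫ s).right) ≫ q.right = 𝟙 _ at h1
      rw [← ht] at h1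
      have := hfin _ ⟨⟨_, h1⟩⟩
      exact hN ⟨⟨inv (t ≫ N.hom) ≫ t, by simp⟩⟩)
    exact hj.1 ⟨⟨k + s, by rw [Preadditive.comp_add, hk]; simp⟩⟩
  · intro X hX h hh
    obtain ⟨x, ⟨i⟩⟩ := hX.exists_phi_iso
    obtain ⟨k, hk⟩ := phi_map_surjective (h ≫ i.inv)
    obtain ⟨l, hl⟩ := hj.2 x trivial k (by
      rintro ⟨⟨s, hs⟩⟩
      refine hh ⟨⟨i.inv ≫ Phi.map s, ?_⟩⟩
      rw [← Category.assoc, ← hk, ← Functor.map_comp, hs, Phi.map_id])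
    exact ⟨Phi.map l ≫ i.hom, by rw [← Category.assoc, ← Functor.map_comp, hl, hk]; simp⟩

theorem isAlmostSplitSeq_phi_map [HasZeroObject C] {N E M : Arrow C} {j : N ⟶ E} {p : E ⟶ M}
    (hfin : ∀ e : N.right ⟶ N.right, IsSplitMono e → IsIso e) (hrows : HasSplitRows j p)
    (hj : IsLeftAlmostSplit ⊤ j) (hp : IsRightAlmostSplit ⊤ p) (hN : ¬ IsSplitEpi N.hom)
    (hM : ¬ IsSplitEpi M.hom) : IsAlmostSplitSeq IsFinPres (Phi.map j) (Phi.map p) := by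
  refine ⟨isFinPres_phi N, isFinPres_phi E, isFinPres_phi M, hrows.phi_shortExact ?_,
    hj.phi_map hfin hN, hp.phi_map hM⟩
  intro X n e he
  -- Injectivity of `Phi.map j`: `e ≫ p.left` is killed by `M.hom`, hence has a lift `e'` killed by
  -- `E.hom`. Then `e - e'` comes from `N.left` and is still sent to `n ≫ j.right`.
  obtain ⟨e', he', h0⟩ := hp.exists_lift_left hM (e ≫ p.left) (by
    rw [Category.assoc, Arrow.w p, reassoc_of% he, hrows.2.1, comp_zero])
  obtain ⟨s, hs⟩ := hrows.1.exists_lift (e - e') (by rw [Preadditive.sub_comp, he', sub_self])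
  refine ⟨s, hrows.2.cancel ?_⟩
  rw [Category.assoc, ← Arrow.w j, reassoc_of% hs, Preadditive.sub_comp, h0, sub_zero, he]

end FromMaps

/-! ### From almost split sequences of functors to maps -/

section FromFunctors

variable {C : Type w} [Category.{v} C] [Preadditive C]

/-- An endomorphism of `M` inducing the identity of `Φ(M)` is an isomorphism. -/
def IsPhiRigid (M : Arrow C) : Prop :=
  ∀ u : M ⟶ M, Phi.map u = 𝟙 _ → IsIso u

section

variable {N E M : Arrow C} {j : N ⟶ E} {p : E ⟶ M}

/-- Maps to `M` killed by `Φ` factor through `p`. -/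
lemma HasSplitRows.exists_factor_right (h : HasSplitRows j p)
    (hinj : ∀ {X : C} (n : X ⟶ N.right), phiMk E (n ≫ j.right) = 0 → phiMk N n = 0)
    {x : Arrow C} (k : x ⟶ M) (hk : Phi.map k = 0) : ∃ l : x ⟶ E, l ≫ p = k := by
  obtain ⟨t, ht⟩ := (phi_map_eq_zero_iff k).1 hk
  have hk' := Arrow.w k
  obtain ⟨-, r, s, -, hs, -⟩ := h.1
  -- `k.left - x.hom ≫ t` is killed by `M.hom`, but its lift along `s` need not be killed by
  -- `E.hom`. The defect comes from a map `n` to `N.right` of class zero in `Phi.obj E`, so by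
  -- `hinj` it is removed by some `q ≫ j.left`.
  obtain ⟨n, hn⟩ := h.2.exists_lift ((k.left - x.hom ≫ t) ≫ s ≫ E.hom) (by
    rw [Category.assoc, Category.assoc, ← Arrow.w p, reassoc_of% hs, Preadditive.sub_comp, hk',
      ← ht, Category.assoc, sub_self])
  obtain ⟨q, hq⟩ := (phiMk_eq_zero_iff N n).1 (hinj n
    ((phiMk_eq_zero_iff E _).2 ⟨_, (Category.assoc _ _ _).trans hn.symm⟩))
  refine ⟨Arrow.homMk ((k.left - x.hom ≫ t) ≫ s - q ≫ j.left + x.hom ≫ t ≫ s) (t ≫ s ≫ E.hom) ?_,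
    ?_⟩
  · rw [Preadditive.add_comp, Preadditive.sub_comp, Category.assoc, Category.assoc, Arrow.w j,
      reassoc_of% hq, hn]
    simp
  · ext
    · simp [Preadditive.add_comp, Preadditive.sub_comp, hs, h.1.1]
    · simp only [Arrow.comp_right, Arrow.homMk_right, Category.assoc]
      rw [← Arrow.w p, reassoc_of% hs, ht]

/-- Maps from `N` killed by `Φ` factor through `j`. -/
lemma HasSplitRows.exists_factor_left (h : HasSplitRows j p) {x : Arrow C} (k : N ⟶ x)
    (hk : Phi.map k = 0) : ∃ l : E ⟶ x, j ≫ l = k := by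
  obtain ⟨t, ht⟩ := (phi_map_eq_zero_iff k).1 hk
  have hk' := Arrow.w k
  obtain ⟨-, r, s, hr, -, -⟩ := h.1
  obtain ⟨-, r', s', hr', -, -⟩ := h.2
  -- `k` is the sum of `(N.hom ≫ t, t ≫ x.hom)` and `(k.left - N.hom ≫ t, 0)`. The first summand
  -- extends by the retraction `r'` of the right row, the second by `r` of the left row.
  refine ⟨Arrow.homMk (E.hom ≫ r' ≫ t + r ≫ (k.left - N.hom ≫ t)) (r' ≫ t ≫ x.hom) ?_, ?_⟩
  · simp [Preadditive.add_comp, Preadditive.sub_comp, ← ht]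
  · ext
    · simp only [Arrow.comp_left, Arrow.homMk_left, Preadditive.comp_add]
      rw [← Category.assoc j.left, Arrow.w j, Category.assoc, reassoc_of% hr', reassoc_of% hr]
      abel
    · simp only [Arrow.comp_right, Arrow.homMk_right]
      rw [reassoc_of% hr', ht]

/-- By rigidity of `M`, a map `k` whose image under `Phi` is a split epi is itself a split epi.
Otherwise `k` factors through `p` up to a null-homotopic map, which factors as well. -/
lemma HasSplitRows.isRightAlmostSplit (h : HasSplitRows j p)
    (hinj : ∀ {X : C} (n : X ⟶ N.right), phiMk E (n ≫ j.right) = 0 → phiMk N n = 0)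
    (hM : IsPhiRigid M) (hp : IsRightAlmostSplit IsFinPres (Phi.map p)) :
    IsRightAlmostSplit ⊤ p := by
  constructor
  · rintro ⟨⟨s, hs⟩⟩
    exact hp.1 ⟨⟨Phi.map s, by rw [← Functor.map_comp, hs, Phi.map_id]⟩⟩
  · intro x _ k hk
    obtain ⟨α, hα⟩ := hp.2 _ (isFinPres_phi x) (Phi.map k) (by
      rintro ⟨⟨σ, hσ⟩⟩
      obtain ⟨s, rfl⟩ := phi_map_surjective σ
      have := hM (s ≫ k) (by rw [Functor.map_comp, hσ])
      exact hk ⟨⟨inv (s ≫ k) ≫ s, by simp⟩⟩)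
    obtain ⟨l, rfl⟩ := phi_map_surjective α
    rw [← Functor.map_comp, eq_comm, phi_map_eq_iff] at hα
    obtain ⟨l', hl'⟩ := h.exists_factor_right hinj (k - l ≫ p) ((phi_map_eq_zero_iff _).2 hα)
    exact ⟨l' + l, by rw [Preadditive.add_comp, hl', sub_add_cancel]⟩

lemma HasSplitRows.isLeftAlmostSplit (h : HasSplitRows j p)
    (hN : IsPhiRigid N) (hj : IsLeftAlmostSplit IsFinPres (Phi.map j)) :
    IsLeftAlmostSplit ⊤ j := by
  constructor
  · rintro ⟨⟨s, hs⟩⟩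
    exact hj.1 ⟨⟨Phi.map s, by rw [← Functor.map_comp, hs, Phi.map_id]⟩⟩
  · intro x _ k hk
    obtain ⟨α, hα⟩ := hj.2 _ (isFinPres_phi x) (Phi.map k) (by
      rintro ⟨⟨σ, hσ⟩⟩
      obtain ⟨s, rfl⟩ := phi_map_surjective σ
      have := hN (k ≫ s) (by rw [Functor.map_comp, hσ])
      exact hk ⟨⟨s ≫ inv (k ≫ s), by rw [← Category.assoc, IsIso.hom_inv_id]⟩⟩)
    obtain ⟨l, rfl⟩ := phi_map_surjective α
    rw [← Functor.map_comp, eq_comm, phi_map_eq_iff] at hα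
    obtain ⟨l', hl'⟩ := h.exists_factor_left (k - j ≫ l) ((phi_map_eq_zero_iff _).2 hα)
    exact ⟨l' + l, by rw [Preadditive.comp_add, hl', sub_add_cancel]⟩

/-- When `M.hom` is a split mono, `Phi.obj M` is a direct summand of a representable functor. The
section of the right row becomes a map of arrows once it is preceded by the idempotent `𝟙 - r ≫
M.hom`, which `M.hom` annihilates; the homotopy is `r`. -/
lemma HasSplitRows.isSplitEpi_phi_map (h : HasSplitRows j p) (hM : IsSplitMono M.hom) :
    IsSplitEpi (Phi.map p) := by
  obtain ⟨⟨r, hr⟩⟩ := hM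
  obtain ⟨-, -, s, -, hs, -⟩ := h.2
  refine ⟨⟨Phi.map (Arrow.homMk (0 : M.left ⟶ E.left) ((𝟙 _ - r ≫ M.hom) ≫ s) ?_), ?_⟩⟩
  · rw [zero_comp, ← Category.assoc, Preadditive.comp_sub, reassoc_of% hr, Category.comp_id,
      sub_self, zero_comp]
  · rw [← Functor.map_comp, ← Phi.map_id, eq_comm, phi_map_eq_iff]
    refine ⟨r, ?_⟩
    simp [hs]

end

lemma isSplitEpi_phi_map_of_isSplitEpi {E M : Arrow C} (p : E ⟶ M) (hM : IsSplitEpi M.hom) :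
    IsSplitEpi (Phi.map p) := by
  obtain ⟨⟨s, hs⟩⟩ := hM
  refine ⟨⟨0, ?_⟩⟩
  rw [zero_comp, ← Phi.map_id, eq_comm, phi_map_eq_zero_iff]
  exact ⟨s, hs⟩

lemma isSplitMono_phi_map_of_isSplitEpi {N E : Arrow C} (j : N ⟶ E) (hN : IsSplitEpi N.hom) :
    IsSplitMono (Phi.map j) := by
  obtain ⟨⟨s, hs⟩⟩ := hN
  refine ⟨⟨0, ?_⟩⟩
  rw [comp_zero, ← Phi.map_id, eq_comm, phi_map_eq_zero_iff]
  exact ⟨s, hs⟩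

lemma isIso_of_app_bijective {D : Type w} [Category.{v} D] {G H : D ⥤ AddCommGrpCat.{v}}
    (α : G ⟶ H) (hα : ∀ X, Function.Bijective (α.app X)) : IsIso α := by
  rw [NatTrans.isIso_iff_isIso_app]
  exact fun X => (ConcreteCategory.isIso_iff_bijective _).2 (hα X)

/-- A split mono has its cokernel as a complement, and `Phi.obj N` is represented by that cokernel;
`s` is the inclusion of the complement. -/
lemma isRepr_phi [HasCokernels C] {N : Arrow C} (hN : IsSplitMono N.hom) :
    IsRepr (Phi.obj N) := by
  obtain ⟨⟨r, hr⟩⟩ := hN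
  let s : cokernel N.hom ⟶ N.right := cokernel.desc N.hom (𝟙 _ - r ≫ N.hom) (by
    rw [Preadditive.comp_sub, reassoc_of% hr, Category.comp_id, sub_self])
  have hπs : cokernel.π N.hom ≫ s = 𝟙 _ - r ≫ N.hom := cokernel.π_desc _ _ _
  have hsπ : s ≫ cokernel.π N.hom = 𝟙 _ := by
    rw [← cancel_epi (cokernel.π N.hom), reassoc_of% hπs]
    simp
  let α := phiDesc N (preadditiveYoneda.obj (cokernel N.hom)) (cokernel.π N.hom)
    (cokernel.condition N.hom)
  have : IsIso α := by
    refine isIso_of_app_bijective α fun X => ⟨?_, fun n => ?_⟩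
    · rw [injective_iff_map_eq_zero]
      intro z hz
      obtain ⟨n, rfl⟩ := exists_phiMk N (X := X.unop) z
      have hz' : n ≫ cokernel.π N.hom = 0 := (phiDesc_app_phiMk _ _ _ _ n).symm.trans hz
      refine (phiMk_eq_zero_iff _ _).2 ⟨n ≫ r, ?_⟩
      have := hz' =≫ s
      rw [Category.assoc, hπs, zero_comp, Preadditive.comp_sub, sub_eq_zero] at this
      simpa using this.symm
    · refine ⟨phiMk N ((show X.unop ⟶ _ from n) ≫ s), (phiDesc_app_phiMk _ _ _ _ _).trans ?_⟩
      change (_ ≫ s) ≫ cokernel.π N.hom = _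
      rw [Category.assoc, hsπ, Category.comp_id]
  exact ⟨_, ⟨(asIso α).symm⟩⟩

/-! ### The horseshoe construction -/

section Horseshoe

variable [HasBinaryBiproducts C] (N M : Arrow C) (w : M.left ⟶ N.right)

/-- The upper triangular map with diagonal entries `N` and `M` and remaining entry `w`. -/
noncomputable def extHom : N.left ⊞ M.left ⟶ N.right ⊞ M.right :=
  biprod.desc (N.hom ≫ biprod.inl) (w ≫ biprod.inl + M.hom ≫ biprod.inr)

lemma extHom_fst : extHom N M w ≫ biprod.fst = biprod.fst ≫ N.hom + biprod.snd ≫ w := by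
  dsimp [extHom]
  ext <;> simp

lemma extHom_snd : extHom N M w ≫ biprod.snd = biprod.snd ≫ M.hom := by
  dsimp [extHom]
  ext <;> simp

/-- The extension of `M` by `N` with split rows given by a map `w`. -/
noncomputable def extArrow : Arrow C := Arrow.mk (extHom N M w)

/-- The inclusion of `N` in an extension. -/
noncomputable def extInl : N ⟶ extArrow N M w :=
  Arrow.homMk (biprod.inl : N.left ⟶ N.left ⊞ M.left) (biprod.inl : _ ⟶ N.right ⊞ M.right)
    (by simp [extArrow, extHom])

/-- The projection of an extension to `M`. -/
noncomputable def extSnd : extArrow N M w ⟶ M :=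
  Arrow.homMk (biprod.snd : N.left ⊞ M.left ⟶ _) (biprod.snd : N.right ⊞ M.right ⟶ _)
    (extHom_snd N M w).symm

lemma hasSplitRows_ext : HasSplitRows (extInl N M w) (extSnd N M w) :=
  ⟨⟨biprod.inl_snd, biprod.fst, biprod.inr, biprod.inl_fst, biprod.inr_snd, biprod.total⟩,
    ⟨biprod.inl_snd, biprod.fst, biprod.inr, biprod.inl_fst, biprod.inr_snd, biprod.total⟩⟩

variable {N M}

lemma exists_ext_iso {H : Cᵒᵖ ⥤ AddCommGrpCat.{v}} [H.Additive] {ρ : Phi.obj N ⟶ H}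
    {θ : H ⟶ Phi.obj M} (hρθ : ρ ≫ θ = 0) (hex : (ShortComplex.mk ρ θ hρθ).ShortExact) :
    ∃ (w : M.left ⟶ N.right) (b : Phi.obj (extArrow N M w) ≅ H),
      Phi.map (extInl N M w) ≫ b.hom = ρ ∧ Phi.map (extSnd N M w) = b.hom ≫ θ := by
  have hpt := (shortExact_iff_pointwise _ _ hρθ).1 hex
  -- `y` lifts the generator of `Phi.obj M` to `H`. It need not be killed by `M.hom`, but `H.map
  -- M.hom.op y` lies in the image of `ρ`; `w` represents its negative, so that the relations cancel
  -- in `hrel`.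
  obtain ⟨y, hy⟩ := (hpt (op M.right)).2.2 (phiMk M (𝟙 _))
  have hθy {X : C} (m : X ⟶ M.right) : θ.app (op X) (H.map m.op y) = phiMk M m := by
    refine (ConcreteCategory.congr_hom (θ.naturality m.op) y).trans ?_
    refine (congrArg ((Phi.obj M).map m.op) hy).trans ?_
    rw [phi_obj_map_phiMk, Category.comp_id]
  obtain ⟨z, hz⟩ := ((hpt (op M.left)).2.1 (-H.map M.hom.op y)).1 (by
    rw [map_neg, neg_eq_zero]
    exact (hθy M.hom).trans ((phiMk_eq_zero_iff M M.hom).2 ⟨𝟙 _, by simp⟩))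
  obtain ⟨w, rfl⟩ := exists_phiMk N z
  have hρ {X Y : C} (a : X ⟶ Y) (n : Y ⟶ N.right) :
      H.map a.op (ρ.app (op Y) (phiMk N n)) = ρ.app (op X) (phiMk N (a ≫ n)) := by
    rw [← phi_obj_map_phiMk]
    exact (ConcreteCategory.congr_hom (ρ.naturality a.op) _).symm
  have hcomp {X Y Z : C} (a : X ⟶ Y) (b : Y ⟶ Z) (e : H.obj (op Z)) :
      H.map (a ≫ b).op e = H.map a.op (H.map b.op e) := by
    rw [op_comp, H.map_comp]
    rfl
  have hz' {X : C} (t : X ⟶ M.left) :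
      H.map (t ≫ M.hom).op y = -ρ.app (op X) (phiMk N (t ≫ w)) := by
    rw [hcomp, ← hρ, hz, map_neg, neg_neg]
  let e : H.obj (op (N.right ⊞ M.right)) :=
    ρ.app (op (N.right ⊞ M.right)) (phiMk N biprod.fst) +
      H.map (biprod.snd : N.right ⊞ M.right ⟶ _).op y
  have he {X : C} (a : X ⟶ N.right ⊞ M.right) : H.map a.op e =
      ρ.app (op X) (phiMk N (a ≫ biprod.fst)) + H.map (a ≫ biprod.snd).op y := by
    rw [map_add, ← hcomp, hρ]
  have hrel : H.map (extHom N M w).op e = 0 := by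
    rw [he, extHom_fst, extHom_snd, hz', phiMk_add, (phiMk_eq_zero_iff N _).2 ⟨_, rfl⟩, zero_add,
      add_neg_cancel]
  let β := phiDesc (extArrow N M w) H e hrel
  have hβ {X : C} (a : X ⟶ N.right ⊞ M.right) : β.app (op X) (phiMk (extArrow N M w) a) =
      ρ.app (op X) (phiMk N (a ≫ biprod.fst)) + H.map (a ≫ biprod.snd).op y :=
    (phiDesc_app_phiMk _ _ _ _ _).trans (he a)
  have hθρ {X : C} (z : (Phi.obj N).obj (op X)) : θ.app (op X) (ρ.app (op X) z) = 0 :=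
    ConcreteCategory.congr_hom (NatTrans.congr_app hρθ (op X)) z
  have h1 : Phi.map (extInl N M w) ≫ β = ρ := by
    apply phi_hom_ext
    refine (congrArg (β.app (op N.right)) (phi_map_app_phiMk (extInl N M w) _)).trans ?_
    refine (hβ (𝟙 _ ≫ biprod.inl)).trans ?_
    simp
  have h2 : Phi.map (extSnd N M w) = β ≫ θ := by
    apply phi_hom_ext
    rw [phi_map_app_phiMk]
    refine Eq.trans ?_ (congrArg (θ.app (op (N.right ⊞ M.right))) (hβ (𝟙 _))).symm
    refine Eq.trans ?_ (map_add (θ.app (op (N.right ⊞ M.right))).hom _ _).symm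
    exact ((congrArg₂ (· + ·) (hθρ _) (hθy _)).trans (zero_add _)).symm
  -- The usual diagram chase: applying `θ` gives the component `t` in `M.left`, and injectivity of
  -- `ρ` then gives the component `s` in `N.left`.
  have hinj {X : C} (a : X ⟶ N.right ⊞ M.right)
      (ha : β.app (op X) (phiMk (extArrow N M w) a) = 0) : phiMk (extArrow N M w) a = 0 := by
    rw [hβ] at ha
    have h3 := congrArg (θ.app (op X)) ha
    rw [map_add, hθρ, hθy, zero_add, map_zero] at h3
    obtain ⟨t, ht⟩ := (phiMk_eq_zero_iff M _).1 h3
    rw [← ht, hz', ← sub_eq_add_neg, ← map_sub, ← phiMk_sub] at ha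
    obtain ⟨s, hs⟩ := (phiMk_eq_zero_iff N _).1
      ((injective_iff_map_eq_zero _).1 (hpt (op X)).1 _ ha)
    have hst : biprod.lift s t ≫ extHom N M w = a := by
      ext
      · simp [extHom_fst, hs]
      · simp [extHom_snd, ht]
    exact (phiMk_eq_zero_iff _ _).2 ⟨_, hst⟩
  have : IsIso β := by
    refine isIso_of_app_bijective β fun X => ⟨?_, fun x => ?_⟩
    · rw [injective_iff_map_eq_zero]
      intro z hz₀
      obtain ⟨a, rfl⟩ := exists_phiMk (extArrow N M w) (X := X.unop) z
      exact hinj a hz₀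
    · obtain ⟨m, hm⟩ := exists_phiMk M (X := X.unop) (θ.app X x)
      obtain ⟨z, hz₁⟩ := ((hpt X).2.1 (x - H.map m.op y)).1 (by
        rw [map_sub, ← hm]
        exact sub_eq_zero.2 (hθy m).symm)
      obtain ⟨n, rfl⟩ := exists_phiMk N (X := X.unop) z
      refine ⟨phiMk (extArrow N M w) (biprod.lift n m), (hβ _).trans ?_⟩
      rw [biprod.lift_fst, biprod.lift_snd]
      exact (congrArg (· + H.map m.op y) hz₁).trans (sub_add_cancel _ _)
  exact ⟨w, asIso β, h1, h2⟩

end Horseshoe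

end FromFunctors

/-! ### Almost split maps under isomorphism -/

section Transport

variable {A : Type w} [Category.{v} A] {P : ObjectProperty A}

lemma IsRightAlmostSplit.of_iso {Y Z Y' Z' : A} {b : Y ⟶ Z} (h : IsRightAlmostSplit P b)
    (i : Y' ≅ Y) (k : Z ≅ Z') : IsRightAlmostSplit P (i.hom ≫ b ≫ k.hom) := by
  constructor
  · rintro ⟨⟨s, hs⟩⟩
    refine h.1 ⟨⟨k.hom ≫ s ≫ i.hom, ?_⟩⟩
    rw [← cancel_mono k.hom]
    simp only [Category.assoc, hs]
    simp
  · intro X hX f hf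
    obtain ⟨l, hl⟩ := h.2 X hX (f ≫ k.inv) (by
      rintro ⟨⟨s, hs⟩⟩
      exact hf ⟨⟨k.inv ≫ s, by rw [← cancel_mono k.inv]; simp [hs]⟩⟩)
    exact ⟨l ≫ i.inv, by simp [reassoc_of% hl]⟩

lemma IsLeftAlmostSplit.of_iso {X Y X' Y' : A} {a : X ⟶ Y} (h : IsLeftAlmostSplit P a)
    (i : X' ≅ X) (k : Y ≅ Y') : IsLeftAlmostSplit P (i.hom ≫ a ≫ k.hom) := by
  constructor
  · rintro ⟨⟨s, hs⟩⟩
    refine h.1 ⟨⟨k.hom ≫ s ≫ i.hom, ?_⟩⟩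
    rw [← cancel_epi i.hom]
    simp only [Category.assoc] at hs
    rw [reassoc_of% hs, Category.comp_id]
  · intro Z hZ f hf
    obtain ⟨l, hl⟩ := h.2 Z hZ (i.inv ≫ f) (by
      rintro ⟨⟨s, hs⟩⟩
      exact hf ⟨⟨s ≫ i.inv, by rw [← cancel_epi i.inv]; simp [reassoc_of% hs]⟩⟩)
    exact ⟨k.inv ≫ l, by simp [hl]⟩

end Transport

section

variable {C : Type w} [Category.{v} C] [Preadditive C] [HasBinaryBiproducts C] [HasCokernels C]

/-- Each excluded splitting would split the functor sequence: a split epi `N.hom` or `M.hom` makes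
the corresponding end term zero, and a split mono `M.hom` makes `Phi.map p` a split epi. A split
mono `N.hom` is not contradictory; it makes `G` representable. -/
theorem exists_almostSplit_of_isPhiRigid {G H F : Cᵒᵖ ⥤ AddCommGrpCat.{v}} {ρ : G ⟶ H}
    {θ : H ⟶ F} (hρθ : IsAlmostSplitSeq IsFinPres ρ θ) {N M : Arrow C} (hN : IsPhiRigid N)
    (hM : IsPhiRigid M) (a : Phi.obj N ≅ G) (c : Phi.obj M ≅ F) :
    ∃ (E : Arrow C) (j : N ⟶ E) (p : E ⟶ M), HasSplitRows j p ∧ IsLeftAlmostSplit ⊤ j ∧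
      IsRightAlmostSplit ⊤ p ∧ ¬ IsSplitEpi N.hom ∧ ¬ IsSplitEpi M.hom ∧ ¬ IsSplitMono M.hom ∧
      (IsSplitMono N.hom → IsRepr G) ∧ ∃ b : Phi.obj E ≅ H,
        Phi.map j ≫ b.hom = a.hom ≫ ρ ∧ Phi.map p ≫ c.hom = b.hom ≫ θ := by
  obtain ⟨-, hH, -, ⟨h0, hex⟩, hl, hr⟩ := hρθ
  have := hH.1
  have h0' : (a.hom ≫ ρ) ≫ θ ≫ c.inv = 0 := by
    rw [Category.assoc, reassoc_of% h0, zero_comp, comp_zero]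
  have hex' : (ShortComplex.mk (a.hom ≫ ρ) (θ ≫ c.inv) h0').ShortExact :=
    ShortComplex.shortExact_of_iso
      (ShortComplex.isoMk (S₁ := ShortComplex.mk ρ θ h0) a.symm (Iso.refl _) c.symm) hex
  obtain ⟨w, b, hb₁, hb₂⟩ := exists_ext_iso h0' hex'
  have hrows := hasSplitRows_ext N M w
  have hl' : IsLeftAlmostSplit IsFinPres (Phi.map (extInl N M w)) := by
    have := hl.of_iso a b.symm
    rwa [Iso.symm_hom, ← Category.assoc, ← hb₁, Category.assoc, Iso.hom_inv_id,
      Category.comp_id] at this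
  have hr' : IsRightAlmostSplit IsFinPres (Phi.map (extSnd N M w)) := by
    have := hr.of_iso b c.symm
    rwa [Iso.symm_hom, ← hb₂] at this
  have hinj {X : C} (n : X ⟶ N.right)
      (hn : phiMk (extArrow N M w) (n ≫ (extInl N M w).right) = 0) : phiMk N n = 0 := by
    rw [← phi_map_app_phiMk] at hn
    have h1 := ((shortExact_iff_pointwise _ _ h0').1 hex' (op X)).1
    refine (injective_iff_map_eq_zero _).1 h1 _ ?_
    rw [← hb₁]
    exact (congrArg (b.hom.app (op X)) hn).trans (map_zero _)
  refine ⟨_, _, _, hrows, hrows.isLeftAlmostSplit hN hl', hrows.isRightAlmostSplit hinj hM hr',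
    fun h => hl'.1 (isSplitMono_phi_map_of_isSplitEpi _ h),
    fun h => hr'.1 (isSplitEpi_phi_map_of_isSplitEpi _ h),
    fun h => hr'.1 (hrows.isSplitEpi_phi_map h), fun h => ?_, b, hb₁, ?_⟩
  · obtain ⟨X, ⟨i⟩⟩ := isRepr_phi h
    exact ⟨X, ⟨i ≪≫ a⟩⟩
  · rw [hb₂]
    simp

end

/-! ### Rigid presentations by minimal length -/

section FiniteLength

variable {L : Type u} [Ring L]

lemma isIso_of_bijective {X Y : FGModuleCat.{u} L} (e : X ⟶ Y)
    (he : Function.Bijective e.hom.hom) : IsIso e := by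
  have : IsIso ((ModuleCat.isFG L).ι.map e) :=
    (ConcreteCategory.isIso_iff_bijective (C := ModuleCat L) e.hom).2 he
  exact isIso_of_reflects_iso e (ModuleCat.isFG L).ι

lemma isIso_of_isSplitMono [IsArtinianRing L] {X : FGModuleCat.{u} L} (e : X ⟶ X)
    (he : IsSplitMono e) : IsIso e := by
  obtain ⟨⟨r, hr⟩⟩ := he
  refine isIso_of_bijective e (IsArtinian.bijective_of_injective_endomorphism _ ?_)
  intro x y hxy
  have h (z : X) : r.hom.hom (e.hom.hom z) = z :=
    congrArg (fun k : X ⟶ X => k.hom.hom z) hr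
  rw [← h x, ← h y, hxy]

/-- The sum of the lengths of the source and the target of a map. -/
noncomputable def arrowLength (f : Arrow (FGModuleCat.{u} L)) : ℕ∞ :=
  Module.length L f.left + Module.length L f.right

section Image

variable {M : Arrow (FGModuleCat.{u} L)} (v : M ⟶ M)

/-- The restriction of `M` to the images of an endomorphism. -/
noncomputable def imageArrow : Arrow (FGModuleCat.{u} L) :=
  Arrow.mk (X := FGModuleCat.of L (LinearMap.range v.left.hom.hom))
    (Y := FGModuleCat.of L (LinearMap.range v.right.hom.hom))
    (FGModuleCat.ofHom (LinearMap.restrict M.hom.hom.hom (by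
      rintro _ ⟨x, rfl⟩
      exact ⟨M.hom.hom.hom x,
        (congrArg (fun k : M.left ⟶ M.right => k.hom.hom x) (Arrow.w v)).symm⟩)))

/-- The inclusion of the image of an endomorphism. -/
noncomputable def imageInc : imageArrow v ⟶ M :=
  Arrow.homMk (FGModuleCat.ofHom (Submodule.subtype _)) (FGModuleCat.ofHom (Submodule.subtype _))
    rfl

/-- The corestriction of an endomorphism to its image. -/
noncomputable def imageProj : M ⟶ imageArrow v :=
  Arrow.homMk (FGModuleCat.ofHom (LinearMap.rangeRestrict v.left.hom.hom))
    (FGModuleCat.ofHom (LinearMap.rangeRestrict v.right.hom.hom)) (by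
      ext x
      exact Subtype.ext (congrArg (fun k : M.left ⟶ M.right => k.hom.hom x) (Arrow.w v)))

lemma imageProj_comp_imageInc : imageProj v ≫ imageInc v = v := rfl

lemma exists_iterate (n : ℕ) (hv : Phi.map v = 𝟙 _) : ∃ w : M ⟶ M, Phi.map w = 𝟙 _ ∧
    w.left.hom.hom = v.left.hom.hom ^ n ∧ w.right.hom.hom = v.right.hom.hom ^ n := by
  induction n with
  | zero => exact ⟨𝟙 _, Phi.map_id _, rfl, rfl⟩
  | succ n ih =>
    obtain ⟨w, h, hl, hr⟩ := ih
    refine ⟨w ≫ v, by rw [Phi.map_comp, h, hv, Category.comp_id], ?_, ?_⟩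
    · rw [pow_succ', ← hl]
      rfl
    · rw [pow_succ', ← hr]
      rfl

variable [IsArtinianRing L]

lemma rangeRestrict_comp_subtype_bijective {X : Type u} [AddCommGroup X] [Module L X]
    [Module.Finite L X] (e : X →ₗ[L] X) (he : LinearMap.range e ≤ LinearMap.range (e * e)) :
    Function.Bijective (e.rangeRestrict ∘ₗ (LinearMap.range e).subtype) := by
  refine IsNoetherian.bijective_of_surjective_endomorphism _ ?_
  rintro ⟨y, hy⟩
  obtain ⟨x, rfl⟩ := he hy
  exact ⟨⟨e x, x, rfl⟩, rfl⟩

/-- Once the images of `v` are stable, `imageInc v ≫ imageProj v` is invertible, so `Phi.map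
(imageInc v)` is mono. The other composite is `v`, which induces the identity, so it is also a split
epi. -/
lemma isIso_phi_imageInc (hv : Phi.map v = 𝟙 _)
    (hl : LinearMap.range v.left.hom.hom ≤ LinearMap.range (v.left.hom.hom * v.left.hom.hom))
    (hr : LinearMap.range v.right.hom.hom ≤ LinearMap.range (v.right.hom.hom * v.right.hom.hom)) :
    IsIso (Phi.map (imageInc v)) := by
  have : IsIso (imageInc v ≫ imageProj v).left :=
    isIso_of_bijective _ (rangeRestrict_comp_subtype_bijective _ hl)
  have : IsIso (imageInc v ≫ imageProj v).right :=
    isIso_of_bijective _ (rangeRestrict_comp_subtype_bijective _ hr)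
  have : IsIso (imageInc v ≫ imageProj v) := Arrow.isIso_of_isIso_left_of_isIso_right _
  have : Mono (Phi.map (imageInc v)) := by
    have : Mono (Phi.map (imageInc v) ≫ Phi.map (imageProj v)) := by
      rw [← Phi.map_comp]
      infer_instance
    exact mono_of_mono _ (Phi.map (imageProj v))
  have : IsSplitEpi (Phi.map (imageInc v)) :=
    ⟨⟨Phi.map (imageProj v), by rw [← Phi.map_comp, imageProj_comp_imageInc, hv]⟩⟩
  exact isIso_of_mono_of_isSplitEpi _

lemma arrowLength_imageArrow_lt (hv : LinearMap.range v.left.hom.hom ≠ ⊤ ∨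
    LinearMap.range v.right.hom.hom ≠ ⊤) : arrowLength (imageArrow v) < arrowLength M := by
  have hl : Module.length L M.left ≠ ⊤ := Module.length_ne_top
  have hr : Module.length L M.right ≠ ⊤ := Module.length_ne_top
  have hl' : Module.length L (LinearMap.range v.left.hom.hom) ≤ Module.length L M.left :=
    Module.length_le_of_injective _ (Submodule.injective_subtype _)
  have hr' : Module.length L (LinearMap.range v.right.hom.hom) ≤ Module.length L M.right :=
    Module.length_le_of_injective _ (Submodule.injective_subtype _)
  rcases hv with hv | hv
  · exact ENat.add_lt_add_of_lt_of_le (ne_top_of_le_ne_top hr hr') (Submodule.length_lt hv) hr'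
  · exact ENat.add_lt_add_of_le_of_lt (ne_top_of_le_ne_top hl hl') hl' (Submodule.length_lt hv)

end Image

/-- In a presentation of least total length, the stable image of an endomorphism inducing the
identity presents the same functor. By minimality it is everything, so the endomorphism is
surjective, hence bijective. -/
theorem exists_isPhiRigid_iso [IsArtinianRing L] {F : (FGModuleCat.{u} L)ᵒᵖ ⥤ AddCommGrpCat.{u}}
    (hF : IsFinPres F) : ∃ M : Arrow (FGModuleCat.{u} L), IsPhiRigid M ∧
      Nonempty (Phi.obj M ≅ F) := by
  have hne : {M : Arrow (FGModuleCat.{u} L) | Nonempty (Phi.obj M ≅ F)}.Nonempty :=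
    hF.exists_phi_iso
  let M := Function.argminOn arrowLength _ hne
  have hM : Nonempty (Phi.obj M ≅ F) := Function.argminOn_mem arrowLength _ hne
  refine ⟨M, fun u hu => ?_, hM⟩
  obtain ⟨n, hn⟩ := Filter.eventually_atTop.1
    ((LinearMap.eventually_iInf_range_pow_eq u.left.hom.hom).and
      (LinearMap.eventually_iInf_range_pow_eq u.right.hom.hom))
  -- The exponent must be positive: surjectivity of the power then passes to its outermost factor
  -- `u`. Comparison with the doubled exponent gives `v` and its square the same range.
  obtain ⟨v, hv, hl, hr⟩ := exists_iterate u (n + 1) hu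
  have h1 := hn (n + 1) (by omega)
  have h2 := hn (n + 1 + (n + 1)) (by omega)
  have := isIso_phi_imageInc v hv
    (by rw [hl, ← pow_add]; exact (h1.1.symm.trans h2.1).le)
    (by rw [hr, ← pow_add]; exact (h1.2.symm.trans h2.2).le)
  have hmin : ¬ arrowLength (imageArrow v) < arrowLength M :=
    Function.not_lt_argminOn arrowLength _ (hM.map ((asIso (Phi.map (imageInc v))).trans ·))
  have htop := mt (arrowLength_imageArrow_lt v) hmin
  rw [not_or, not_not, not_not, hl, hr, LinearMap.range_eq_top, LinearMap.range_eq_top,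
    pow_succ', pow_succ'] at htop
  have : IsIso u.left := isIso_of_bijective _
    (IsNoetherian.bijective_of_surjective_endomorphism _ (Function.Surjective.of_comp htop.1))
  have : IsIso u.right := isIso_of_bijective _
    (IsNoetherian.bijective_of_surjective_endomorphism _ (Function.Surjective.of_comp htop.2))
  exact Arrow.isIso_of_isIso_left_of_isIso_right u

end FiniteLength

/-! ### Maps as modules over the triangular matrix ring -/

section ToTri

variable {L : Type u} [Ring L]

/-- The lower triangular matrix with entries `a`, `b` and `c`. -/
def triMat (a b c : L) : Tri L := ⟨!![a, 0; b, c], rfl⟩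

lemma triMat_mul (a b c a' b' c' : L) :
    triMat a b c * triMat a' b' c' = triMat (a * a') (b * a' + c * b') (c * c') := by
  apply Subtype.ext
  change !![a, 0; b, c] * !![a', 0; b', c'] = !![a * a', 0; b * a' + c * b', c * c']
  rw [Matrix.mul_fin_two]
  simp

lemma triMat_add (a b c a' b' c' : L) :
    triMat a b c + triMat a' b' c' = triMat (a + a') (b + b') (c + c') := by
  apply Subtype.ext
  change !![a, 0; b, c] + !![a', 0; b', c'] = !![a + a', 0; b + b', c + c']
  simp

lemma eq_triMat (m : Tri L) : m = triMat (m.1 0 0) (m.1 1 0) (m.1 1 1) := by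
  apply Subtype.ext
  have h : m.1 0 1 = 0 := m.2
  change m.1 = !![m.1 0 0, 0; m.1 1 0, m.1 1 1]
  rw [← h]
  exact Matrix.eta_fin_two _

/-- The diagonal embedding of `L` in the triangular matrix ring. -/
def triDiag : L →+* Tri L where
  toFun a := triMat a 0 a
  map_one' := by
    apply Subtype.ext
    exact Matrix.one_fin_two.symm
  map_zero' := by
    apply Subtype.ext
    change !![(0 : L), 0; 0, 0] = 0
    ext i j
    fin_cases i <;> fin_cases j <;> rfl
  map_add' a b := by rw [triMat_add, add_zero]
  map_mul' a b := by rw [triMat_mul]; simp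

lemma isFG_toTri (f : Arrow (FGModuleCat.{u} L)) :
    ModuleCat.isFG (Tri L) (toTri.obj f) := by
  obtain ⟨s, hsf, hs⟩ := Submodule.fg_def.1 (Module.Finite.fg_top (R := L) (M := f.left))
  obtain ⟨t, htf, ht⟩ := Submodule.fg_def.1 (Module.Finite.fg_top (R := L) (M := f.right))
  let i₁ : f.left → TriSpace f := fun x => ((x, 0) : f.left × f.right)
  let i₂ : f.right → TriSpace f := fun y => ((0, y) : f.left × f.right)
  let S : Submodule (Tri L) (TriSpace f) := Submodule.span (Tri L) (i₁ '' s ∪ i₂ '' t)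
  have h₁ (x : f.left) : i₁ x ∈ S := by
    have hx : x ∈ Submodule.span L s := hs ▸ Submodule.mem_top
    induction hx using Submodule.span_induction with
    | mem x hx => exact Submodule.subset_span (Or.inl ⟨x, hx, rfl⟩)
    | zero => exact S.zero_mem
    | add x y _ _ hx hy =>
      have : i₁ (x + y) = i₁ x + i₁ y := Prod.ext rfl (add_zero (0 : f.right)).symm
      exact this ▸ S.add_mem hx hy
    | smul a x _ hx =>
      have : i₁ (a • x) = triMat a 0 0 • i₁ x := by
        refine Prod.ext rfl ?_
        change (0 : f.right) = (0 : L) • f.hom.hom.hom x + (0 : L) • (0 : f.right)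
        simp
      exact this ▸ S.smul_mem _ hx
  have h₂ (y : f.right) : i₂ y ∈ S := by
    have hy : y ∈ Submodule.span L t := ht ▸ Submodule.mem_top
    induction hy using Submodule.span_induction with
    | mem x hx => exact Submodule.subset_span (Or.inr ⟨x, hx, rfl⟩)
    | zero => exact S.zero_mem
    | add x y _ _ hx hy =>
      have : i₂ (x + y) = i₂ x + i₂ y := Prod.ext (add_zero (0 : f.left)).symm rfl
      exact this ▸ S.add_mem hx hy
    | smul a x _ hx =>
      have : i₂ (a • x) = triMat 0 0 a • i₂ x := by
        refine Prod.ext (zero_smul L (0 : f.left)).symm ?_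
        change a • x = (0 : L) • f.hom.hom.hom 0 + a • x
        simp
      exact this ▸ S.smul_mem _ hx
  refine ⟨Submodule.fg_def.2 ⟨i₁ '' s ∪ i₂ '' t, (hsf.image _).union (htf.image _), ?_⟩⟩
  refine (Submodule.eq_top_iff' (p := S)).2 fun x => ?_
  have : x = i₁ x.1 + i₂ x.2 := Prod.ext (add_zero x.1).symm (zero_add x.2).symm
  exact this ▸ S.add_mem (h₁ _) (h₂ _)

instance : (toTri (L := L)).Faithful where
  map_injective {f g h k} hhk := by
    have e (x : f.left × f.right) : ((h.left.hom.hom x.1, h.right.hom.hom x.2) :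
        g.left × g.right) = (k.left.hom.hom x.1, k.right.hom.hom x.2) :=
      congrArg (fun l : toTri.obj f ⟶ toTri.obj g => l.hom x) hhk
    ext x
    · exact congrArg Prod.fst (e (x, 0))
    · exact congrArg Prod.snd (e (0, x))

instance : (toTri (L := L)).Full where
  map_surjective {f g} l := by
    let i₁ : f.left → TriSpace f := fun x => ((x, 0) : f.left × f.right)
    let i₂ : f.right → TriSpace f := fun y => ((0, y) : f.left × f.right)
    let l' : TriSpace f →ₗ[Tri L] TriSpace g := l.hom
    have h₁ (b : L) (a : L) (x : f.left) : triMat a b 0 • i₁ x = i₁ (a • x) +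
        i₂ (b • f.hom.hom.hom x) := by
      refine Prod.ext (add_zero (a • x)).symm ?_
      change b • f.hom.hom.hom x + (0 : L) • (0 : f.right) = 0 + b • f.hom.hom.hom x
      simp
    have h₂ (c : L) (y : f.right) : triMat 0 0 c • i₂ y = i₂ (c • y) := by
      refine Prod.ext (zero_smul L (0 : f.left)) ?_
      change (0 : L) • f.hom.hom.hom 0 + c • y = c • y
      simp
    have i₁_zero : i₁ 0 = 0 := rfl
    have i₂_zero : i₂ 0 = 0 := rfl
    -- Linearity over the two diagonal idempotents forces `l'` to respect the two summands;
    -- linearity over the lower left matrix unit later gives the commutative square.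
    have h₃ (x : f.left) : l' (i₁ x) = triMat (1 : L) 0 0 • l' (i₁ x) := by
      rw [← map_smul, h₁]
      simp [i₂_zero]
    have h₄ (y : f.right) : l' (i₂ y) = triMat (0 : L) 0 1 • l' (i₂ y) := by
      rw [← map_smul, h₂]
      simp
    let l₁ : f.left →ₗ[L] g.left :=
      { toFun := fun x => (l' (i₁ x)).1
        map_add' := fun x y => by
          have : i₁ (x + y) = i₁ x + i₁ y := Prod.ext rfl (add_zero (0 : f.right)).symm
          rw [this, map_add]
          rfl
        map_smul' := fun a x => by
          have := h₁ 0 a x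
          rw [zero_smul, i₂_zero, add_zero] at this
          rw [← this, map_smul]
          rfl }
    let l₂ : f.right →ₗ[L] g.right :=
      { toFun := fun x => (l' (i₂ x)).2
        map_add' := fun x y => by
          have : i₂ (x + y) = i₂ x + i₂ y := Prod.ext (add_zero (0 : f.left)).symm rfl
          rw [this, map_add]
          rfl
        map_smul' := fun a x => by
          rw [← h₂, map_smul]
          change (0 : L) • g.hom.hom.hom (l' (i₂ x)).1 + a • (l' (i₂ x)).2 = a • (l' (i₂ x)).2
          rw [zero_smul, zero_add] }
    refine ⟨Arrow.homMk (FGModuleCat.ofHom l₁) (FGModuleCat.ofHom l₂) ?_, ?_⟩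
    · ext x
      change g.hom.hom.hom (l' (i₁ x)).1 = (l' (i₂ (f.hom.hom.hom x))).2
      have := h₁ 1 0 x
      rw [zero_smul, one_smul, i₁_zero, zero_add] at this
      rw [← this, map_smul]
      change _ = (1 : L) • g.hom.hom.hom (l' (i₁ x)).1 + (0 : L) • (l' (i₁ x)).2
      simp
    · ext x
      change (((l' (i₁ x.1)).1, (l' (i₂ x.2)).2) : g.left × g.right) = l' x
      have hx : x = i₁ x.1 + i₂ x.2 := Prod.ext (add_zero x.1).symm (zero_add x.2).symm
      have hl : l' x = l' (i₁ x.1) + l' (i₂ x.2) := (congrArg l' hx).trans (map_add _ _ _)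
      rw [hl]
      refine Prod.ext ?_ ?_
      · change (l' (i₁ x.1)).1 = (l' (i₁ x.1)).1 + (l' (i₂ x.2)).1
        rw [h₄ x.2]
        change _ = _ + (0 : L) • (l' (i₂ x.2)).1
        simp
      · change (l' (i₂ x.2)).2 = (l' (i₁ x.1)).2 + (l' (i₂ x.2)).2
        rw [h₃ x.1]
        change _ = ((0 : L) • g.hom.hom.hom (l' (i₁ x.1)).1 + (0 : L) • (l' (i₁ x.1)).2) + _
        simp

section EssSurj

variable (X : Type u) [AddCommGroup X] [Module (Tri L) X]

/-- A module over the triangular matrix ring as an `L`-module. -/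
abbrev diagModule : Module L X := Module.compHom X (triDiag (L := L))

lemma finite_diagModule [Module.Finite (Tri L) X] :
    letI := diagModule (L := L) X
    Module.Finite L X := by
  let _ := diagModule (L := L) X
  have hd (a : L) (x : X) : a • x = triMat a 0 a • x := rfl
  obtain ⟨s, hsf, hs⟩ := Submodule.fg_def.1 (Module.Finite.fg_top (R := Tri L) (M := X))
  -- The three matrix units applied to generators suffice over `L`: multiplying a unit on the right
  -- by a triangular matrix gives a left `L`-combination of these units. The lower left unit is
  -- needed because the lower right one produces it.
  let S : Submodule L X := Submodule.span L ((triMat (1 : L) 0 0 • ·) '' s ∪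
    ((triMat (0 : L) 1 0 • ·) '' s ∪ (triMat (0 : L) 0 1 • ·) '' s))
  have key (x : X) : triMat (1 : L) 0 0 • x ∈ S ∧ triMat (0 : L) 1 0 • x ∈ S ∧
      triMat (0 : L) 0 1 • x ∈ S := by
    have hx : x ∈ Submodule.span (Tri L) s := hs ▸ Submodule.mem_top
    induction hx using Submodule.span_induction with
    | mem x hx =>
      exact ⟨Submodule.subset_span (Or.inl ⟨x, hx, rfl⟩),
        Submodule.subset_span (Or.inr (Or.inl ⟨x, hx, rfl⟩)),
        Submodule.subset_span (Or.inr (Or.inr ⟨x, hx, rfl⟩))⟩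
    | zero => simp
    | add x y _ _ hx hy =>
      simp only [smul_add]
      exact ⟨S.add_mem hx.1 hy.1, S.add_mem hx.2.1 hy.2.1, S.add_mem hx.2.2 hy.2.2⟩
    | smul m x _ hx =>
      rw [eq_triMat m]
      generalize m.1 0 0 = a
      generalize m.1 1 0 = b
      generalize m.1 1 1 = c
      refine ⟨?_, ?_, ?_⟩
      · have := S.smul_mem a hx.1
        rw [hd, smul_smul, triMat_mul] at this
        rw [smul_smul, triMat_mul]
        simpa using this
      · have := S.smul_mem a hx.2.1
        rw [hd, smul_smul, triMat_mul] at this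
        rw [smul_smul, triMat_mul]
        simpa using this
      · have := S.add_mem (S.smul_mem b hx.2.1) (S.smul_mem c hx.2.2)
        rw [hd, hd, smul_smul, triMat_mul, smul_smul, triMat_mul, ← add_smul, triMat_add] at this
        rw [smul_smul, triMat_mul]
        simpa using this
  refine ⟨Submodule.fg_def.2 ⟨_, (hsf.image _).union ((hsf.image _).union (hsf.image _)),
    (Submodule.eq_top_iff' (p := S)).2 fun x => ?_⟩⟩
  have := S.add_mem (key x).1 (key x).2.2
  rw [← add_smul, triMat_add] at this
  have h1 : triMat (1 + 0 : L) (0 + 0) (0 + 1) = 1 := by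
    rw [add_zero, add_zero, zero_add]
    exact (triDiag (L := L)).map_one
  rwa [h1, one_smul] at this

end EssSurj

/-- Peirce decomposition: the diagonal idempotents split `X` into two summands, and the lower left
matrix unit acts as a map from the first to the second. -/
lemma exists_toTri_iso {X : ModuleCat.{u} (Tri L)} (hX : ModuleCat.isFG (Tri L) X) :
    ∃ f : Arrow (FGModuleCat.{u} L), Nonempty (toTri.obj f ≅ X) := by
  let _ := diagModule (L := L) X
  have : Module.Finite (Tri L) X := hX
  have : Module.Finite L X := finite_diagModule X
  have hd (a : L) (x : X) : a • x = triMat a 0 a • x := rfl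
  let e₁ : X →ₗ[L] X :=
    { toFun := fun x => triMat (1 : L) 0 0 • x
      map_add' := smul_add _
      map_smul' := fun a x => by
        rw [RingHom.id_apply, hd, hd, smul_smul, smul_smul, triMat_mul, triMat_mul]
        simp }
  let e₂ : X →ₗ[L] X :=
    { toFun := fun x => triMat (0 : L) 0 1 • x
      map_add' := smul_add _
      map_smul' := fun a x => by
        rw [RingHom.id_apply, hd, hd, smul_smul, smul_smul, triMat_mul, triMat_mul]
        simp }
  let e₂₁ : X →ₗ[L] X :=
    { toFun := fun x => triMat (0 : L) 1 0 • x
      map_add' := smul_add _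
      map_smul' := fun a x => by
        rw [RingHom.id_apply, hd, hd, smul_smul, smul_smul, triMat_mul, triMat_mul]
        simp }
  have h₁ (x : X) (hx : x ∈ LinearMap.range e₁) : triMat (1 : L) 0 0 • x = x := by
    obtain ⟨y, rfl⟩ := hx
    change triMat (1 : L) 0 0 • triMat (1 : L) 0 0 • y = triMat (1 : L) 0 0 • y
    rw [smul_smul, triMat_mul]
    simp
  have h₂ (x : X) (hx : x ∈ LinearMap.range e₂) : triMat (0 : L) 0 1 • x = x := by
    obtain ⟨y, rfl⟩ := hx
    change triMat (0 : L) 0 1 • triMat (0 : L) 0 1 • y = triMat (0 : L) 0 1 • y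
    rw [smul_smul, triMat_mul]
    simp
  have h₂₁ (x : X) (_ : x ∈ LinearMap.range e₁) : e₂₁ x ∈ LinearMap.range e₂ := by
    refine ⟨e₂₁ x, ?_⟩
    change triMat (0 : L) 0 1 • triMat (0 : L) 1 0 • x = triMat (0 : L) 1 0 • x
    rw [smul_smul, triMat_mul]
    simp
  let f : Arrow (FGModuleCat.{u} L) :=
    Arrow.mk (X := FGModuleCat.of L (LinearMap.range e₁))
      (Y := FGModuleCat.of L (LinearMap.range e₂)) (FGModuleCat.ofHom (e₂₁.restrict h₂₁))
  have hzero : triMat (0 : L) 0 0 = 0 := (triDiag (L := L)).map_zero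
  let φ : TriSpace f →ₗ[Tri L] X :=
    { toFun := fun x : LinearMap.range e₁ × LinearMap.range e₂ => x.1.1 + x.2.1
      map_add' := fun x y => add_add_add_comm x.1.1 y.1.1 x.2.1 y.2.1
      map_smul' := fun m => by
        rw [eq_triMat m]
        generalize m.1 0 0 = a
        generalize m.1 1 0 = b
        generalize m.1 1 1 = c
        rintro ⟨⟨x, hx⟩, ⟨y, hy⟩⟩
        change triMat a 0 a • x + (triMat b 0 b • triMat (0 : L) 1 0 • x + triMat c 0 c • y) =
          triMat a b c • (x + y)
        rw [← h₁ x hx, ← h₂ y hy]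
        simp only [smul_add, smul_smul, triMat_mul]
        rw [← add_assoc, ← add_smul, triMat_add]
        simp }
  have hφ : Function.Bijective φ := by
    constructor
    · rw [injective_iff_map_eq_zero]
      rintro ⟨⟨x, hx⟩, ⟨y, hy⟩⟩ h
      replace h : x + y = 0 := h
      have hx0 := congrArg (triMat (1 : L) 0 0 • ·) h
      have hy0 := congrArg (triMat (0 : L) 0 1 • ·) h
      simp only [smul_add, smul_zero] at hx0 hy0
      rw [h₁ x hx, ← h₂ y hy, smul_smul, triMat_mul] at hx0
      rw [h₂ y hy, ← h₁ x hx, smul_smul, triMat_mul] at hy0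
      simp [hzero] at hx0 hy0
      exact Prod.ext (Subtype.ext hx0) (Subtype.ext hy0)
    · intro x
      refine ⟨((⟨e₁ x, x, rfl⟩, ⟨e₂ x, x, rfl⟩) : LinearMap.range e₁ × LinearMap.range e₂), ?_⟩
      change triMat (1 : L) 0 0 • x + triMat (0 : L) 0 1 • x = x
      have h1 : triMat (1 + 0 : L) (0 + 0) (0 + 1) = 1 := by
        rw [add_zero, add_zero, zero_add]
        exact (triDiag (L := L)).map_one
      rw [← add_smul, triMat_add, h1, one_smul]
  exact ⟨f, ⟨(LinearEquiv.ofBijective φ hφ).toModuleIso⟩⟩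

lemma isRightAlmostSplit_toTri_iff {E M : Arrow (FGModuleCat.{u} L)} (p : E ⟶ M) :
    IsRightAlmostSplit (ModuleCat.isFG (Tri L)) (toTri.map p) ↔ IsRightAlmostSplit ⊤ p := by
  refine and_congr (not_congr (toTri.isSplitEpi_iff p)) ⟨fun h x _ k hk => ?_, fun h X hX k hk => ?_⟩
  · obtain ⟨l, hl⟩ := h _ (isFG_toTri x) (toTri.map k) (mt (toTri.isSplitEpi_iff k).1 hk)
    obtain ⟨l, rfl⟩ := toTri.map_surjective l
    exact ⟨l, toTri.map_injective (by rw [toTri.map_comp, hl])⟩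
  · obtain ⟨x, ⟨i⟩⟩ := exists_toTri_iso hX
    obtain ⟨k', hk'⟩ := toTri.map_surjective (i.hom ≫ k)
    obtain ⟨l, hl⟩ := h x trivial k' (by
      rintro ⟨⟨s, hs⟩⟩
      exact hk ⟨⟨toTri.map s ≫ i.hom, by
        rw [Category.assoc, ← hk', ← toTri.map_comp, hs, toTri.map_id]⟩⟩)
    exact ⟨i.inv ≫ toTri.map l, by rw [Category.assoc, ← toTri.map_comp, hl, hk']; simp⟩

lemma isLeftAlmostSplit_toTri_iff {N E : Arrow (FGModuleCat.{u} L)} (j : N ⟶ E) :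
    IsLeftAlmostSplit (ModuleCat.isFG (Tri L)) (toTri.map j) ↔ IsLeftAlmostSplit ⊤ j := by
  refine and_congr (not_congr (toTri.isSplitMono_iff j))
    ⟨fun h x _ k hk => ?_, fun h X hX k hk => ?_⟩
  · obtain ⟨l, hl⟩ := h _ (isFG_toTri x) (toTri.map k) (mt (toTri.isSplitMono_iff k).1 hk)
    obtain ⟨l, rfl⟩ := toTri.map_surjective l
    exact ⟨l, toTri.map_injective (by rw [toTri.map_comp, hl])⟩
  · obtain ⟨x, ⟨i⟩⟩ := exists_toTri_iso hX
    obtain ⟨k', hk'⟩ := toTri.map_surjective (k ≫ i.inv)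
    obtain ⟨l, hl⟩ := h x trivial k' (by
      rintro ⟨⟨s, hs⟩⟩
      exact hk ⟨⟨i.inv ≫ toTri.map s, by
        rw [← Category.assoc, ← hk', ← toTri.map_comp, hs, toTri.map_id]⟩⟩)
    exact ⟨toTri.map l ≫ i.hom, by rw [← Category.assoc, ← toTri.map_comp, hl, hk']; simp⟩

/-- A short exact sequence of finitely generated modules with a section is split. -/
lemma isSplitSeq_of_section {X Y Z : FGModuleCat.{u} L} {a : X ⟶ Y} {b : Y ⟶ Z}
    (ha : Function.Injective a.hom.hom) (hab : Function.Exact a.hom.hom b.hom.hom)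
    {s : Z ⟶ Y} (hs : s ≫ b = 𝟙 Z) : IsSplitSeq a b := by
  have h0 : a ≫ b = 0 := by
    ext x
    exact hab.apply_apply_eq_zero x
  have hmem (y : Y) : (𝟙 Y - b ≫ s : Y ⟶ Y).hom.hom y ∈ LinearMap.range a.hom.hom := by
    refine (hab _).1 ?_
    have : (𝟙 Y - b ≫ s) ≫ b = 0 := by
      rw [Preadditive.sub_comp, Category.assoc, hs, Category.id_comp, Category.comp_id, sub_self]
    exact congrArg (fun k : Y ⟶ Z => k.hom.hom y) this
  let r : Y ⟶ X := FGModuleCat.ofHom ((LinearEquiv.ofInjective a.hom.hom ha).symm.toLinearMap ∘ₗ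
    LinearMap.codRestrict _ _ hmem)
  have hr : r ≫ a = 𝟙 Y - b ≫ s := by
    ext y
    exact congrArg Subtype.val
      ((LinearEquiv.ofInjective a.hom.hom ha).apply_symm_apply ⟨_, hmem y⟩)
  refine ⟨h0, r, s, ?_, hs, by rw [hr, sub_add_cancel]⟩
  ext x
  refine ha ?_
  have : (a ≫ r) ≫ a = a := by
    rw [Category.assoc, hr, Preadditive.comp_sub, reassoc_of% h0, zero_comp, sub_zero,
      Category.comp_id]
  exact congrArg (fun k : X ⟶ Y => k.hom.hom x) this

lemma IsSplitSeq.injective_exact_surjective {X Y Z : FGModuleCat.{u} L} {a : X ⟶ Y} {b : Y ⟶ Z}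
    (h : IsSplitSeq a b) : Function.Injective a.hom.hom ∧
      Function.Exact a.hom.hom b.hom.hom ∧ Function.Surjective b.hom.hom := by
  obtain ⟨h0, r, s, hr, hs, hrs⟩ := h
  have h0' (x : X) : b.hom.hom (a.hom.hom x) = 0 := congrArg (fun k : X ⟶ Z => k.hom.hom x) h0
  have hr' (x : X) : r.hom.hom (a.hom.hom x) = x := congrArg (fun k : X ⟶ X => k.hom.hom x) hr
  have hs' (x : Z) : b.hom.hom (s.hom.hom x) = x := congrArg (fun k : Z ⟶ Z => k.hom.hom x) hs
  have hrs' (y : Y) : a.hom.hom (r.hom.hom y) + s.hom.hom (b.hom.hom y) = y :=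
    congrArg (fun k : Y ⟶ Y => k.hom.hom y) hrs
  refine ⟨fun x y hxy => by rw [← hr' x, ← hr' y, hxy], fun y => ⟨fun hy => ?_, ?_⟩,
    fun z => ⟨_, hs' z⟩⟩
  · have := hrs' y
    rw [hy, map_zero, add_zero] at this
    exact ⟨r.hom.hom y, this⟩
  · rintro ⟨x, rfl⟩
    exact h0' x

/-- The underlying functions of `toTri.map j` and `toTri.map p` are products of the component maps,
so injectivity, exactness and surjectivity are all tested row by row. -/
lemma toTri_shortExact_iff {N E M : Arrow (FGModuleCat.{u} L)} (j : N ⟶ E) (p : E ⟶ M) :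
    (∃ h : toTri.map j ≫ toTri.map p = 0,
      (ShortComplex.mk (toTri.map j) (toTri.map p) h).ShortExact) ↔
    (Function.Injective j.left.hom.hom ∧ Function.Exact j.left.hom.hom p.left.hom.hom ∧
      Function.Surjective p.left.hom.hom) ∧
    (Function.Injective j.right.hom.hom ∧ Function.Exact j.right.hom.hom p.right.hom.hom ∧
      Function.Surjective p.right.hom.hom) := by
  have hj : ⇑(toTri.map j).hom = Prod.map j.left.hom.hom j.right.hom.hom := rfl
  have hp : ⇑(toTri.map p).hom = Prod.map p.left.hom.hom p.right.hom.hom := rfl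
  have hex : Function.Exact (toTri.map j).hom (toTri.map p).hom ↔
      Function.Exact j.left.hom.hom p.left.hom.hom ∧
        Function.Exact j.right.hom.hom p.right.hom.hom := by
    constructor
    · intro h
      constructor
      · intro x
        constructor
        · intro hx
          obtain ⟨y, hy⟩ := (h ((x, 0) : E.left × E.right)).1
            (Prod.ext hx (map_zero p.right.hom.hom))
          exact ⟨y.1, congrArg Prod.fst hy⟩
        · rintro ⟨y, rfl⟩
          exact congrArg Prod.fst (h.apply_apply_eq_zero ((y, 0) : N.left × N.right))
      · intro x
        constructor
        · intro hx
          obtain ⟨y, hy⟩ := (h ((0, x) : E.left × E.right)).1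
            (Prod.ext (map_zero p.left.hom.hom) hx)
          exact ⟨y.2, congrArg Prod.snd hy⟩
        · rintro ⟨y, rfl⟩
          exact congrArg Prod.snd (h.apply_apply_eq_zero ((0, y) : N.left × N.right))
    · rintro ⟨h₁, h₂⟩ x
      constructor
      · intro hx
        obtain ⟨y, hy⟩ := (h₁ x.1).1 (congrArg Prod.fst hx)
        obtain ⟨z, hz⟩ := (h₂ x.2).1 (congrArg Prod.snd hx)
        exact ⟨((y, z) : N.left × N.right), Prod.ext hy hz⟩
      · rintro ⟨y, rfl⟩
        exact Prod.ext (h₁.apply_apply_eq_zero y.1) (h₂.apply_apply_eq_zero y.2)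
  have hinj : Function.Injective (toTri.map j).hom ↔
      Function.Injective j.left.hom.hom ∧ Function.Injective j.right.hom.hom := by
    rw [hj]
    exact Prod.map_injective
  have hsurj : Function.Surjective (toTri.map p).hom ↔
      Function.Surjective p.left.hom.hom ∧ Function.Surjective p.right.hom.hom := by
    rw [hp]
    exact Prod.map_surjective
  rw [and_and_and_comm, and_and_and_comm (b := Function.Surjective _), ← hex, ← hinj, ← hsurj]
  constructor
  · rintro ⟨h0, h⟩
    exact ⟨h.moduleCat_injective_f,
      (ShortComplex.ShortExact.moduleCat_exact_iff_function_exact _).1 h.exact,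
      h.moduleCat_surjective_g⟩
  · rintro ⟨h₁, h₂, h₃⟩
    have h0 : toTri.map j ≫ toTri.map p = 0 := by
      ext x
      exact h₂.apply_apply_eq_zero x
    have hm : Mono (toTri.map j) := (ModuleCat.mono_iff_injective _).2 h₁
    have he : Epi (toTri.map p) := (ModuleCat.epi_iff_surjective _).2 h₃
    exact ⟨h0, @ShortComplex.ShortExact.mk _ _ _ _
      ((ShortComplex.ShortExact.moduleCat_exact_iff_function_exact _).2 h₂) hm he⟩

end ToTri

end MapsCat

theorem mainTheorem2 {R : Type v} [CommRing R] [IsArtinianRing R]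
    {L : Type u} [Ring L] [Algebra R L] [Module.Finite R L] :
    (∀ (N E M : Arrow (FGModuleCat.{u} L)) (j : N ⟶ E) (p : E ⟶ M),
      MapsCat.IsAlmostSplitSeq (ModuleCat.isFG (MapsCat.Tri L))
          (MapsCat.toTri.map j) (MapsCat.toTri.map p) →
        ¬ IsSplitEpi N.hom → ¬ IsSplitMono N.hom → ¬ IsSplitEpi M.hom → ¬ IsSplitMono M.hom →
          MapsCat.IsAlmostSplitSeq MapsCat.IsFinPres
            (MapsCat.Phi.map j) (MapsCat.Phi.map p)) ∧
    (∀ (G H F : (FGModuleCat.{u} L)ᵒᵖ ⥤ AddCommGrpCat.{u}) (ρ : G ⟶ H) (θ : H ⟶ F),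
      MapsCat.IsAlmostSplitSeq MapsCat.IsFinPres ρ θ →
        ∃ (N E M : Arrow (FGModuleCat.{u} L)) (j : N ⟶ E) (p : E ⟶ M),
          MapsCat.IsAlmostSplitSeq (ModuleCat.isFG (MapsCat.Tri L))
              (MapsCat.toTri.map j) (MapsCat.toTri.map p) ∧
            ¬ IsSplitEpi N.hom ∧ ¬ IsSplitEpi M.hom ∧ ¬ IsSplitMono M.hom ∧
            (IsSplitMono N.hom → MapsCat.IsRepr G) ∧
            ∃ (a : MapsCat.Phi.obj N ≅ G) (b : MapsCat.Phi.obj E ≅ H)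
              (c : MapsCat.Phi.obj M ≅ F),
              MapsCat.Phi.map j ≫ b.hom = a.hom ≫ ρ ∧
                MapsCat.Phi.map p ≫ c.hom = b.hom ≫ θ) := by
  have : IsArtinianRing L := IsArtinianRing.of_finite R L
  constructor
  · rintro N E M j p ⟨-, -, -, hex, hj, hp⟩ hN - hM hM'
    rw [MapsCat.isLeftAlmostSplit_toTri_iff] at hj
    rw [MapsCat.isRightAlmostSplit_toTri_iff] at hp
    rw [MapsCat.toTri_shortExact_iff] at hex
    obtain ⟨s, hs⟩ := hp.exists_section_left hM'
    obtain ⟨s', hs'⟩ := hp.exists_section_right hM'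
    exact MapsCat.isAlmostSplitSeq_phi_map MapsCat.isIso_of_isSplitMono
      ⟨MapsCat.isSplitSeq_of_section hex.1.1 hex.1.2.1 hs,
        MapsCat.isSplitSeq_of_section hex.2.1 hex.2.2.1 hs'⟩ hj hp hN hM
  · intro G H F ρ θ h
    obtain ⟨N, hN, ⟨a⟩⟩ := MapsCat.exists_isPhiRigid_iso h.1
    obtain ⟨M, hM, ⟨c⟩⟩ := MapsCat.exists_isPhiRigid_iso h.2.2.1
    obtain ⟨E, j, p, hrows, hj, hp, h1, h2, h3, h4, b, hb⟩ :=
      MapsCat.exists_almostSplit_of_isPhiRigid h hN hM a c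
    exact ⟨N, E, M, j, p, ⟨MapsCat.isFG_toTri N, MapsCat.isFG_toTri E, MapsCat.isFG_toTri M,
      (MapsCat.toTri_shortExact_iff j p).2 ⟨hrows.1.injective_exact_surjective,
        hrows.2.injective_exact_surjective⟩, (MapsCat.isLeftAlmostSplit_toTri_iff j).2 hj,
      (MapsCat.isRightAlmostSplit_toTri_iff p).2 hp⟩, h1, h2, h3, h4, a, b, c, hb⟩
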